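/- A finite hypergraph $H=(V,F)$ consists of a finite vertex set $V$ and a set $F$ of non-empty subsets (hyperedges) of $V$; its bipartite graph joins $i\in V$ and $\alpha\in F$ iff $i\in\alpha$. $H$ is connected if this bipartite graph is, and the nullity $n(H)$ is the cyclomatic number of the bipartite graph, so that $n(H)=\sum_{\alpha\in F}|\alpha|-|V|-|F|+1$ for connected $H$. Let $d_i$ be the number of hyperedges that contain $i$. For a measure space $(\mathcal X,\nu)$ and a statistic $\phi:\mathcal X\to\mathbb R^N$, put $\psi(\theta)=\log\int e^{\langle\theta,\phi\rangle}d\nu$, $\Theta=\operatorname{int}\{\theta:\psi(\theta)<\infty\}$, $p_\theta=e^{\langle\theta,\phi\rangle-\psi(\theta)}$, $Y=\{\mathbb E_{p_\theta}[\phi]:\theta\in\Theta\}$ and $\varphi(\eta)=\sup_{\theta\in\Theta}(\langle\theta,\eta\rangle-\psi(\theta))$; the exponential family is $\mathcal E=\{p_\theta:\theta\in\Theta\}$. An inference family $\mathcal I$ on $H$ consists of exponential families $\mathcal E_i$ on $(\mathcal X_i,\nu_i)$ with statistic $\phi_i$ for $i\in V$ and $\mathcal E_\alpha$ on $\prod_{i\in\alpha}(\mathcal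 X_i,\nu_i)$ with statistic $\phi_\alpha=(\phi_{\langle\alpha\rangle},(\phi_i)_{i\in\alpha})$ for $\alpha\in F$, such that all covariance matrices of $\phi_i$ under members of $\mathcal E_i$ and of $\phi_\alpha$ under members of $\mathcal E_\alpha$ are invertible, and such that for $i\in\alpha$ the marginal on $\mathcal X_i$ of each member of $\mathcal E_\alpha$ belongs to $\mathcal E_i$. Write $\eta_\alpha=(\eta_{\langle\alpha\rangle},(\eta^\alpha_i)_{i\in\alpha})$ and let $$L=\Big\{(\eta_\alpha,\eta_i)\in\prod_{\alpha}Y_\alpha\times\prod_iY_i:\ \eta^\alpha_i=\eta_i\ \text{ for all } i\in\alpha\in F\Big\}.$$ For compatibility functions $\Psi_\alpha=e^{\langle\bar\theta_\alpha,\phi_\alpha\rangle}$ the Bethe free energy is $$F(\eta)=-\sum_{\alpha}\langle\bar\theta_\alpha,\eta_\alpha\rangle+\sum_\alpha\varphi_\alpha(\eta_\alpha)+\sum_{i}(1-d_i)\varphi_i(\eta_i),\qquad \eta\in L.$$ That $F$ is convex on $L$ means that $F$ is convex on every convex subset of $L$; if $L$ is convex, this is ordinary convexity on $L$. **Theorem.**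 Let $H$ be a connected hypergraph. (i) If $n(H)\in\{0,1\}$, then for every inference family on $H$ and all $\bar\theta=(\bar\theta_\alpha)_{\alpha\in F}$, $F$ is convex on $L$. (ii) The converse holds for each of the following families and every $\bar\theta$, i.e. if $F$ is convex on $L$, then $n(H)\in\{0,1\}$: (a) multinomial inference families: each $\mathcal X_i$ is finite with at least two elements, $\nu_i$ is uniform, and $\mathcal E_i$, $\mathcal E_\alpha$ consist of all positive probability densities on $\mathcal X_i$ and on $\prod_{i\in\alpha}\mathcal X_i$; (b) the Gaussian inference family: $\mathcal X_i=\mathbb R$ with Lebesgue measure, $\phi_i=(x_i,x_i^2)$, $\phi_{\langle\alpha\rangle}=(x_ix_j)_{\{i,j\}\subseteq\alpha,\,i\ne j}$; (c) the fixed-mean Gaussian inference family for any mean vector $(\mu_i)_{i\in V}$: $\mathcal X_i=\mathbb R$ with Lebesgue measure, $\phi_i=(x_i-\mu_i)^2$, $\phi_{\langle\alpha\rangle}=((x_i-\mu_i)(x_j-\mu_j))_{\{i,j\}\subseteq\alpha,\,i\ne j}$. -/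

import Mathlib

open MeasureTheory ProbabilityTheory

namespace BetheHyper

noncomputable section

/-! ### Hypergraphs -/

/-- A finite hypergraph with vertex set the whole (finite) type `V`; its hyperedges form a set of
non-empty subsets of `V`. -/
structure FinHypergraph (V : Type*) where
  /-- the set of hyperedges -/
  edges : Finset (Finset V)
  /-- hyperedges are non-empty -/
  nonempty_of_mem : ∀ α ∈ edges, α.Nonempty

namespace FinHypergraph

variable {V : Type*} (H : FinHypergraph V)

/-- The bipartite graph of a hypergraph: a vertex `i` and a hyperedge `α` are joined
iff `i ∈ α`. -/
def bipartite : SimpleGraph (V ⊕ H.edges) :=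
  SimpleGraph.fromRel fun a b => ∃ (i : V) (α : H.edges), a = Sum.inl i ∧ b = Sum.inr α ∧ i ∈ α.1

/-- A hypergraph is connected iff its bipartite graph is. -/
def Connected : Prop := H.bipartite.Connected

/-- The number of incidences `i ∈ α`, i.e. the number of edges of the bipartite graph. -/
def numIncidences : ℕ := ∑ α ∈ H.edges, α.card

/-- The number of connected components. -/
def numComponents : ℕ := Nat.card H.bipartite.ConnectedComponent

/-- The nullity (cyclomatic number) of the bipartite graph:
number of edges, minus number of vertices, plus number of components. -/
def nullity [Fintype V] : ℤ :=
  (H.numIncidences : ℤ) - ((Fintype.card V : ℤ) + (H.edges.card : ℤ)) + (H.numComponents : ℤ)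

/-- The degree of a vertex: the number of hyperedges that contain it. -/
def degree [DecidableEq V] (i : V) : ℕ := (H.edges.filter fun α => i ∈ α).card

end FinHypergraph

/-! ### Exponential families -/

namespace ExpFamily

variable {Ω ι : Type*} [MeasurableSpace Ω] [Fintype ι] (ν : Measure Ω) (φ : Ω → ι → ℝ)

/-- The set of natural parameters: the interior of the set where the log partition function
is finite. -/
def natDomain : Set (ι → ℝ) :=
  interior {θ | Integrable (fun x => Real.exp (∑ j, θ j * φ x j)) ν}

/-- The log partition function. -/
def logPartition (θ : ι → ℝ) : ℝ :=
  Real.log (∫ x, Real.exp (∑ j, θ j * φ x j) ∂ν)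

/-- The density, with respect to the base measure `ν`, of the member with natural parameter `θ`. -/
def density (θ : ι → ℝ) (x : Ω) : ℝ :=
  Real.exp (∑ j, θ j * φ x j - logPartition ν φ θ)

/-- The probability law of the member with natural parameter `θ`. -/
def law (θ : ι → ℝ) : Measure Ω :=
  ν.withDensity fun x => ENNReal.ofReal (density ν φ θ x)

/-- The expectation parameter of the member with natural parameter `θ`. -/
def meanParam (θ : ι → ℝ) : ι → ℝ := fun j => ∫ x, φ x j ∂(law ν φ θ)

/-- The set of expectation parameters. -/
def meanDomain : Set (ι → ℝ) := meanParam ν φ '' natDomain ν φ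

/-- The covariance matrix of the sufficient statistic
(which is the Hessian of the log partition function). -/
def covMatrix (θ : ι → ℝ) : Matrix ι ι ℝ :=
  Matrix.of fun j k => covariance (fun x => φ x j) (fun x => φ x k) (law ν φ θ)

open Classical in
/-- The covariance matrix is invertible at every natural parameter. -/
def IsNondegenerate : Prop := ∀ θ ∈ natDomain ν φ, IsUnit (covMatrix ν φ θ)

/-- The Legendre transform of the log partition function. -/
def legendre (η : ι → ℝ) : ℝ :=
  sSup ((fun θ : ι → ℝ => ∑ j, θ j * η j - logPartition ν φ θ) '' natDomain ν φ)

/-- The exponential family consists of exactly all everywhere positive probability densities. -/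
def IsAllPositiveDensities : Prop :=
  {p : Ω → ℝ | ∃ θ ∈ natDomain ν φ, p = density ν φ θ} =
    {p : Ω → ℝ | (∀ x, 0 < p x) ∧ ∫ x, p x ∂ν = 1}

end ExpFamily

/-! ### Local exponential families on a hypergraph -/

universe u v w₁ w₂

/-- Base measures and sufficient statistics: a base measure `ν i` and a statistic `φV i` on the
space `X i` of each vertex, and an additional statistic `φF α` on `∏ i ∈ α, X i` for each
hyperedge. -/
structure LocalFamily {V : Type u} (H : FinHypergraph V) (X : V → Type v)
    [∀ i, MeasurableSpace (X i)] where
  /-- index type of the components of the vertex statistic -/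
  J : V → Type w₁
  /-- finitely many components -/
  fintypeJ : ∀ i, Fintype (J i)
  /-- index type of the components of the additional hyperedge statistic -/
  K : H.edges → Type w₂
  /-- finitely many components -/
  fintypeK : ∀ α, Fintype (K α)
  /-- base measure of a vertex -/
  ν : ∀ i, Measure (X i)
  /-- statistic of a vertex -/
  φV : ∀ i, X i → J i → ℝ
  /-- additional statistic of a hyperedge -/
  φF : ∀ α : H.edges, (∀ i : α.1, X i) → K α → ℝ

attribute [instance] LocalFamily.fintypeJ LocalFamily.fintypeK

namespace LocalFamily

variable {V : Type u} {H : FinHypergraph V} {X : V → Type v} [∀ i, MeasurableSpace (X i)]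
variable (I : LocalFamily.{u, v, w₁, w₂} H X)

/-- Index type of the components of the full statistic of the hyperedge `α`. -/
abbrev Idx (α : H.edges) : Type (max u w₁ w₂) := I.K α ⊕ (Σ i : α.1, I.J i)

/-- The full statistic of `α`: the additional statistic together with the statistics of
all vertices of `α`. -/
def stat (α : H.edges) (x : ∀ i : α.1, X i) : I.Idx α → ℝ :=
  Sum.elim (I.φF α x) fun p => I.φV p.1 (x p.1) p.2

/-- The base measure of `α`, the product of the base measures of its vertices. -/
def baseF (α : H.edges) : Measure (∀ i : α.1, X i) := Measure.pi fun i : α.1 => I.ν i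

/-- The local exponential families form an inference family: non-degenerate (the covariance
matrices are invertible) and closed under marginalization to a vertex. -/
structure IsInferenceFamily : Prop where
  sigmaFinite : ∀ i, SigmaFinite (I.ν i)
  ne_zero : ∀ i, I.ν i ≠ 0
  measurable_φV : ∀ i j, Measurable fun x => I.φV i x j
  measurable_φF : ∀ α k, Measurable fun x => I.φF α x k
  nondegenerateV : ∀ i, ExpFamily.IsNondegenerate (I.ν i) (I.φV i)
  nondegenerateF : ∀ α, ExpFamily.IsNondegenerate (I.baseF α) (I.stat α)
  marginallyClosed : ∀ (α : H.edges) (i : α.1),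
    ∀ θ ∈ ExpFamily.natDomain (I.baseF α) (I.stat α),
      ∃ θ' ∈ ExpFamily.natDomain (I.ν i) (I.φV i),
        (ExpFamily.law (I.baseF α) (I.stat α) θ).map (fun x => x i) =
          ExpFamily.law (I.ν i) (I.φV i) θ'

/-- Collections `(η_α, η_i)` of parameters of all hyperedges and all vertices. -/
abbrev Params : Type (max u w₁ w₂) := (∀ α : H.edges, I.Idx α → ℝ) × (∀ i, I.J i → ℝ)

/-- The set `L` of pseudomarginals: collections of expectation parameters for which the components
of `η_α` that belong to a vertex `i ∈ α` agree with `η_i`. -/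
def L : Set I.Params :=
  {η | (∀ α, η.1 α ∈ ExpFamily.meanDomain (I.baseF α) (I.stat α)) ∧
    (∀ i, η.2 i ∈ ExpFamily.meanDomain (I.ν i) (I.φV i)) ∧
    ∀ (α : H.edges) (i : α.1) (j : I.J i), η.1 α (Sum.inr ⟨i, j⟩) = η.2 i j}

/-- The Bethe free energy, where `θbar α` is the natural parameter of the compatibility function
`Ψ_α = exp ⟨θbar α, φ_α⟩`. -/
def bethe [Fintype V] [DecidableEq V] (θbar : ∀ α : H.edges, I.Idx α → ℝ) (η : I.Params) : ℝ :=
  -(∑ α, ∑ k, θbar α k * η.1 α k)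
    + ∑ α, ExpFamily.legendre (I.baseF α) (I.stat α) (η.1 α)
    + ∑ i, (1 - (H.degree i : ℝ)) * ExpFamily.legendre (I.ν i) (I.φV i) (η.2 i)

/-- Multinomial inference families (on finite spaces `X i`): the base measures are uniform, and the
exponential families of vertices and of hyperedges consist of all positive densities. -/
structure IsMultinomial : Prop where
  uniform : ∀ i, ∃ c : ENNReal, c ≠ 0 ∧ c ≠ ⊤ ∧ I.ν i = c • Measure.count
  vertex : ∀ i, ExpFamily.IsAllPositiveDensities (I.ν i) (I.φV i)
  hyperedge : ∀ α, ExpFamily.IsAllPositiveDensities (I.baseF α) (I.stat α)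

end LocalFamily

/-- The product `y i * y j` over an unordered pair `{i, j}`. -/
def pairProd {ι : Type*} (y : ι → ℝ) : Sym2 ι → ℝ :=
  Sym2.lift ⟨fun i j => y i * y j, fun i j => mul_comm (y i) (y j)⟩

/-- Fixed-mean Gaussian inference family with mean vector `m`, with Lebesgue base measure on `ℝ`:
statistics `(x_i - m_i)²` and `((x_i - m_i) * (x_j - m_j))` over unordered pairs
of distinct `i, j ∈ α`. -/
def fixedMeanGaussian {V : Type u} [DecidableEq V] (H : FinHypergraph V) (m : V → ℝ) :
    LocalFamily.{u, 0, 0, u} H (fun _ => ℝ) where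
  J _ := Unit
  fintypeJ _ := inferInstance
  K α := {s : Sym2 α.1 // ¬ s.IsDiag}
  fintypeK _ := inferInstance
  ν _ := volume
  φV i x _ := (x - m i) ^ 2
  φF _ x s := pairProd (fun i => x i - m i) s.1

/-- Gaussian inference family, with Lebesgue base measure on `ℝ`: statistics `(x_i, x_i²)` and
`(x_i * x_j)` over unordered pairs of distinct `i, j ∈ α`. -/
def gaussian {V : Type u} [DecidableEq V] (H : FinHypergraph V) :
    LocalFamily.{u, 0, 0, u} H (fun _ => ℝ) where
  J _ := Fin 2
  fintypeJ _ := inferInstance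
  K α := {s : Sym2 α.1 // ¬ s.IsDiag}
  fintypeK _ := inferInstance
  ν _ := volume
  φV _ x := ![x, x ^ 2]
  φF _ x s := pairProd x s.1

/-! ### Convexity -/

/-- `f` is convex on `S`, where `S` itself need not be convex: `f` is convex on each convex subset
of `S`. If `S` is convex, this is the usual notion, see `isConvexFunOn_iff`. -/
def IsConvexFunOn {E : Type*} [AddCommGroup E] [Module ℝ E] (S : Set E) (f : E → ℝ) : Prop :=
  ∀ C ⊆ S, Convex ℝ C → ConvexOn ℝ C f

theorem isConvexFunOn_iff {E : Type*} [AddCommGroup E] [Module ℝ E] {S : Set E}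
    (hS : Convex ℝ S) (f : E → ℝ) : IsConvexFunOn S f ↔ ConvexOn ℝ S f :=
  ⟨fun h => h S subset_rfl hS, fun h _ hC hconv => h.subset hC hconv⟩

end

end BetheHyper

/-!
Suppose first that the bipartite graph has at most one cycle. Then its edges can be oriented so that
every hyperedge and every vertex owns at most one of them, and `F` regroups as a linear form plus
terms `φ_α`, `φ_i` and `φ_α - φ_i`. The differences are convex too: the Bregman divergence of `φ` is
a Kullback-Leibler divergence, which can only decrease under marginalization.

For the converse, choose pairs of pseudomarginals that degenerate in such a way that the midpoint
gaps of all `φ_α` and all `φ_i` converge to one and the same `c < 0`: the laws concentrate at two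
distinct points in the multinomial case, and the coordinates become fully correlated in the Gaussian
case. The gap of `F` then tends to `c * (|F| + ∑ i, (1 - d i)) = c * (1 - n(H))`, and convexity
makes it nonpositive in the limit.
-/

namespace BetheHyper

noncomputable section

open Filter Topology InformationTheory

universe u v w₁ w₂

namespace ExpFamily

section

variable {Ω ι : Type*} [MeasurableSpace Ω] [Fintype ι] {ν : Measure Ω} {φ : Ω → ι → ℝ}
  {θ θ' : ι → ℝ}

theorem integrable_exp_of_mem_natDomain (hθ : θ ∈ natDomain ν φ) :
    Integrable (fun x => Real.exp (θ ⬝ᵥ φ x)) ν := by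
  have hmem := interior_subset hθ
  exact hmem

theorem log_density (θ : ι → ℝ) (x : Ω) :
    Real.log (density ν φ θ x) = θ ⬝ᵥ φ x - logPartition ν φ θ :=
  Real.log_exp _

variable [NeZero ν]

theorem exp_logPartition (hθ : θ ∈ natDomain ν φ) :
    Real.exp (logPartition ν φ θ) = ∫ x, Real.exp (θ ⬝ᵥ φ x) ∂ν :=
  Real.exp_log (integral_exp_pos (integrable_exp_of_mem_natDomain hθ))

theorem law_eq_tilted (hθ : θ ∈ natDomain ν φ) :
    law ν φ θ = ν.tilted fun x => θ ⬝ᵥ φ x := by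
  simp only [law, density, Real.exp_sub, exp_logPartition hθ, Measure.tilted]
  rfl

theorem isProbabilityMeasure_law (hθ : θ ∈ natDomain ν φ) :
    IsProbabilityMeasure (law ν φ θ) :=
  law_eq_tilted hθ ▸ isProbabilityMeasure_tilted (integrable_exp_of_mem_natDomain hθ)

theorem law_eq_tilted_law (hθ : θ ∈ natDomain ν φ) (hθ' : θ' ∈ natDomain ν φ) :
    law ν φ θ' = (law ν φ θ).tilted fun x => (θ' - θ) ⬝ᵥ φ x := by
  rw [law_eq_tilted hθ, law_eq_tilted hθ',
    tilted_tilted (integrable_exp_of_mem_natDomain hθ)]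
  congr with x
  simp [sub_dotProduct]

theorem integrable_exp_law (hθ : θ ∈ natDomain ν φ) (hθ' : θ' ∈ natDomain ν φ) :
    Integrable (fun x => Real.exp ((θ' - θ) ⬝ᵥ φ x)) (law ν φ θ) := by
  rw [law_eq_tilted hθ, integrable_tilted_iff (integrable_exp_of_mem_natDomain hθ)]
  simpa [← Real.exp_add, sub_dotProduct] using integrable_exp_of_mem_natDomain hθ'

theorem log_integral_exp_law (hθ : θ ∈ natDomain ν φ) (hθ' : θ' ∈ natDomain ν φ) :
    Real.log (∫ x, Real.exp ((θ' - θ) ⬝ᵥ φ x) ∂law ν φ θ) =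
      logPartition ν φ θ' - logPartition ν φ θ := by
  rw [law_eq_tilted hθ, integral_exp_tilted, ← exp_logPartition hθ,
    show ∫ x, _ ∂ν = Real.exp (logPartition ν φ θ') by
      simp [exp_logPartition hθ', sub_dotProduct],
    ← Real.exp_sub, Real.log_exp]

theorem integrable_statistic (hθ : θ ∈ natDomain ν φ) (j : ι) :
    Integrable (fun x => φ x j) (law ν φ θ) := by
  classical
  refine integrable_of_mem_interior_integrableExpSet (mem_interior_iff_mem_nhds.2 ?_)
  have hline : Tendsto (fun s : ℝ => θ + s • (Pi.single j 1 : ι → ℝ)) (𝓝 0) (𝓝 θ) :=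
    Continuous.tendsto' (by fun_prop) _ _ (by simp)
  filter_upwards [hline (isOpen_interior.mem_nhds hθ)] with s hs
  simpa [integrableExpSet] using integrable_exp_law hθ hs

theorem integrable_dotProduct_statistic (hθ : θ ∈ natDomain ν φ) (t : ι → ℝ) :
    Integrable (fun x => t ⬝ᵥ φ x) (law ν φ θ) :=
  integrable_finsetSum _ fun j _ => (integrable_statistic hθ j).const_mul _

theorem integral_dotProduct_statistic (hθ : θ ∈ natDomain ν φ) (t : ι → ℝ) :
    ∫ x, t ⬝ᵥ φ x ∂law ν φ θ = t ⬝ᵥ meanParam ν φ θ := by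
  simp only [dotProduct]
  rw [integral_finsetSum _ fun j _ => (integrable_statistic hθ j).const_mul _]
  simp only [integral_const_mul, meanParam]

theorem klDiv_law_ne_top (hθ : θ ∈ natDomain ν φ) (hθ' : θ' ∈ natDomain ν φ) :
    klDiv (law ν φ θ) (law ν φ θ') ≠ ⊤ := by
  have := isProbabilityMeasure_law hθ
  have hexp := integrable_exp_law hθ hθ'
  rw [law_eq_tilted_law hθ hθ']
  refine klDiv_ne_top (absolutelyContinuous_tilted hexp) ?_
  refine integrable_llr_tilted_right .rfl (integrable_dotProduct_statistic hθ _) ?_ hexp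
  exact (integrable_zero _ _ _).congr (llr_self _).symm

theorem toReal_klDiv_law (hθ : θ ∈ natDomain ν φ) (hθ' : θ' ∈ natDomain ν φ) :
    (klDiv (law ν φ θ) (law ν φ θ')).toReal =
      θ ⬝ᵥ meanParam ν φ θ - logPartition ν φ θ
        - (θ' ⬝ᵥ meanParam ν φ θ - logPartition ν φ θ') := by
  have := isProbabilityMeasure_law hθ
  have := isProbabilityMeasure_law hθ'
  have hexp := integrable_exp_law hθ hθ'
  have hllr : llr (law ν φ θ) (law ν φ θ) =ᵐ[law ν φ θ] 0 := llr_self _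
  rw [toReal_klDiv_of_measure_eq (law_eq_tilted_law hθ hθ' ▸ absolutelyContinuous_tilted hexp)
      (by simp), law_eq_tilted_law hθ hθ',
    integral_llr_tilted_right .rfl (integrable_dotProduct_statistic hθ _) hexp
      ((integrable_zero _ _ _).congr hllr.symm),
    integral_congr_ae hllr, log_integral_exp_law hθ hθ', integral_dotProduct_statistic hθ,
    sub_dotProduct]
  simp only [Pi.zero_apply, integral_zero]
  ring

theorem legendre_meanParam (hθ : θ ∈ natDomain ν φ) :
    legendre ν φ (meanParam ν φ θ) = θ ⬝ᵥ meanParam ν φ θ - logPartition ν φ θ := by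
  refine IsGreatest.csSup_eq ⟨⟨θ, hθ, rfl⟩, ?_⟩
  rintro _ ⟨θ', hθ', rfl⟩
  exact sub_nonneg.1 (toReal_klDiv_law hθ hθ' ▸ ENNReal.toReal_nonneg)

theorem toReal_klDiv_law_eq_legendre (hθ : θ ∈ natDomain ν φ) (hθ' : θ' ∈ natDomain ν φ) :
    (klDiv (law ν φ θ) (law ν φ θ')).toReal =
      legendre ν φ (meanParam ν φ θ) - legendre ν φ (meanParam ν φ θ')
        - θ' ⬝ᵥ (meanParam ν φ θ - meanParam ν φ θ') := by
  rw [toReal_klDiv_law hθ hθ', legendre_meanParam hθ, legendre_meanParam hθ', dotProduct_sub]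
  ring

theorem legendre_meanParam_eq_integral_log_density (hθ : θ ∈ natDomain ν φ) :
    legendre ν φ (meanParam ν φ θ) = ∫ x, Real.log (density ν φ θ x) ∂law ν φ θ := by
  have := isProbabilityMeasure_law hθ
  simp only [log_density]
  rw [legendre_meanParam hθ,
    integral_sub (integrable_dotProduct_statistic hθ θ) (integrable_const _),
    integral_dotProduct_statistic hθ]
  simp

end

end ExpFamily

namespace IsConvexFunOn

variable {E F : Type*} [AddCommGroup E] [Module ℝ E] [AddCommGroup F] [Module ℝ F] {S T : Set E}
  {f g : E → ℝ}

theorem of_exists_support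
    (h : ∀ x ∈ S, ∃ s : E →ₗ[ℝ] ℝ, ∀ y ∈ S, f x + s (y - x) ≤ f y) : IsConvexFunOn S f := by
  refine fun C hCS hC => ⟨hC, fun x hx y hy a b ha hb hab => ?_⟩
  obtain ⟨s, hs⟩ := h _ (hCS (hC hx hy ha hb hab))
  have hcancel : a • (x - (a • x + b • y)) + b • (y - (a • x + b • y)) = 0 := by
    rw [← eq_sub_iff_add_eq] at hab
    subst hab
    module
  calc f (a • x + b • y)
      = a • (f (a • x + b • y) + s (x - (a • x + b • y)))
          + b • (f (a • x + b • y) + s (y - (a • x + b • y))) := by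
        rw [smul_add, smul_add, add_add_add_comm, ← add_smul, hab, one_smul, ← map_smul,
          ← map_smul, ← map_add, hcancel, map_zero, add_zero]
    _ ≤ a • f x + b • f y := by
        gcongr
        exacts [hs x (hCS hx), hs y (hCS hy)]

theorem mono (h : IsConvexFunOn T f) (hST : S ⊆ T) : IsConvexFunOn S f :=
  fun C hCS => h C (hCS.trans hST)

theorem comp_linearMap {T : Set F} {f : F → ℝ} (h : IsConvexFunOn T f) (g : E →ₗ[ℝ] F) :
    IsConvexFunOn (g ⁻¹' T) fun x => f (g x) := fun C hCT hC =>
  ((h _ (Set.image_subset_iff.2 hCT) (hC.linear_image g)).comp_linearMap g).subset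
    (Set.subset_preimage_image g C) hC

theorem linearMap (l : E →ₗ[ℝ] ℝ) : IsConvexFunOn S l := fun _ _ hC => l.convexOn hC

theorem add (hf : IsConvexFunOn S f) (hg : IsConvexFunOn S g) :
    IsConvexFunOn S fun x => f x + g x :=
  fun C hCS hC => (hf C hCS hC).add (hg C hCS hC)

theorem finsetSum {κ : Type*} {s : Finset κ} {f : κ → E → ℝ}
    (h : ∀ k ∈ s, IsConvexFunOn S (f k)) : IsConvexFunOn S fun x => ∑ k ∈ s, f k x := by
  classical
  induction s using Finset.induction_on with
  | empty => exact linearMap (0 : E →ₗ[ℝ] ℝ)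
  | insert a s ha ih =>
    simp only [Finset.sum_insert ha]
    exact (h a (Finset.mem_insert_self a s)).add
      (ih fun k hk => h k (Finset.mem_insert_of_mem hk))

end IsConvexFunOn

namespace ExpFamily

variable {Ω ι : Type*} [MeasurableSpace Ω] [Fintype ι] {ν : Measure Ω} [NeZero ν] {φ : Ω → ι → ℝ}

theorem isConvexFunOn_legendre : IsConvexFunOn (meanDomain ν φ) (legendre ν φ) := by
  refine .of_exists_support ?_
  rintro _ ⟨θ, hθ, rfl⟩
  refine ⟨dotProductBilin ℝ ℝ θ, ?_⟩
  rintro _ ⟨θ', hθ', rfl⟩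
  have hkl := toReal_klDiv_law_eq_legendre hθ' hθ ▸ ENNReal.toReal_nonneg
  rw [dotProductBilin_apply_apply]
  linarith

variable {Ω' ι' : Type*} [MeasurableSpace Ω'] [Fintype ι'] {ν' : Measure Ω'} [NeZero ν']
  {φ' : Ω' → ι' → ℝ} {g : Ω → Ω'} {θ₁ θ₂ : ι → ℝ} {τ₁ τ₂ : ι' → ℝ}

theorem legendre_sub_tangent_le_of_map_law (hg : Measurable g)
    (hθ₁ : θ₁ ∈ natDomain ν φ) (hθ₂ : θ₂ ∈ natDomain ν φ)
    (hτ₁ : τ₁ ∈ natDomain ν' φ') (hτ₂ : τ₂ ∈ natDomain ν' φ')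
    (h₁ : (law ν φ θ₁).map g = law ν' φ' τ₁) (h₂ : (law ν φ θ₂).map g = law ν' φ' τ₂) :
    legendre ν' φ' (meanParam ν' φ' τ₁) - legendre ν' φ' (meanParam ν' φ' τ₂)
        - τ₂ ⬝ᵥ (meanParam ν' φ' τ₁ - meanParam ν' φ' τ₂) ≤
      legendre ν φ (meanParam ν φ θ₁) - legendre ν φ (meanParam ν φ θ₂)
        - θ₂ ⬝ᵥ (meanParam ν φ θ₁ - meanParam ν φ θ₂) := by
  have := isProbabilityMeasure_law hθ₁
  have := isProbabilityMeasure_law hθ₂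
  rw [← toReal_klDiv_law_eq_legendre hθ₁ hθ₂, ← toReal_klDiv_law_eq_legendre hτ₁ hτ₂, ← h₁, ← h₂]
  exact ENNReal.toReal_mono (klDiv_law_ne_top hθ₁ hθ₂) (klDiv_map_le _ _ hg)

end ExpFamily

namespace LocalFamily

variable {V : Type u} {H : FinHypergraph V} {X : V → Type v} [∀ i, MeasurableSpace (X i)]
variable {I : LocalFamily.{u, v, w₁, w₂} H X}

variable (I) in
/-- Closedness under marginalization to a vertex, without the non-degeneracy that an inference
family has: covariance matrices may be singular. -/
structure IsMarginallyClosed : Prop where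
  sigmaFinite : ∀ i, SigmaFinite (I.ν i)
  ne_zero : ∀ i, I.ν i ≠ 0
  exists_map_law_eq : ∀ (α : H.edges) (i : α.1),
    ∀ θ ∈ ExpFamily.natDomain (I.baseF α) (I.stat α),
      ∃ θ' ∈ ExpFamily.natDomain (I.ν i) (I.φV i),
        (ExpFamily.law (I.baseF α) (I.stat α) θ).map (fun x => x i) =
          ExpFamily.law (I.ν i) (I.φV i) θ'

theorem IsInferenceFamily.isMarginallyClosed (hI : I.IsInferenceFamily) : I.IsMarginallyClosed :=
  ⟨hI.sigmaFinite, hI.ne_zero, hI.marginallyClosed⟩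

namespace IsMarginallyClosed

open ExpFamily

theorem baseF_ne_zero (hI : I.IsMarginallyClosed) (α : H.edges) : I.baseF α ≠ 0 := by
  have := hI.sigmaFinite
  rw [← Measure.measure_univ_ne_zero, baseF, Measure.pi_univ, Finset.prod_ne_zero_iff]
  exact fun i _ => Measure.measure_univ_ne_zero.2 (hI.ne_zero i)

theorem exists_map_law_eq_meanParam_eq (hI : I.IsMarginallyClosed) (α : H.edges) (i : α.1)
    {θ : I.Idx α → ℝ} (hθ : θ ∈ natDomain (I.baseF α) (I.stat α)) :
    ∃ τ ∈ natDomain (I.ν i) (I.φV i),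
      (law (I.baseF α) (I.stat α) θ).map (fun x => x i) = law (I.ν i) (I.φV i) τ ∧
        meanParam (I.ν i) (I.φV i) τ =
          fun j => meanParam (I.baseF α) (I.stat α) θ (Sum.inr ⟨i, j⟩) := by
  have : NeZero (I.ν i) := ⟨hI.ne_zero i⟩
  obtain ⟨τ, hτ, hmap⟩ := hI.exists_map_law_eq α i θ hθ
  refine ⟨τ, hτ, hmap, funext fun j => ?_⟩
  rw [meanParam, ← hmap, integral_map (measurable_pi_apply i).aemeasurable
    (hmap ▸ (integrable_statistic hτ j).aestronglyMeasurable)]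
  rfl

theorem isConvexFunOn_legendre_sub (hI : I.IsMarginallyClosed) (α : H.edges) (i : α.1) :
    IsConvexFunOn I.L fun η =>
      legendre (I.baseF α) (I.stat α) (η.1 α) - legendre (I.ν i) (I.φV i) (η.2 i) := by
  have : NeZero (I.baseF α) := ⟨hI.baseF_ne_zero α⟩
  have : NeZero (I.ν i) := ⟨hI.ne_zero i⟩
  have hparam : ∀ η ∈ I.L, ∃ θ ∈ natDomain (I.baseF α) (I.stat α),
      ∃ τ ∈ natDomain (I.ν i) (I.φV i),
        (law (I.baseF α) (I.stat α) θ).map (fun x => x i) = law (I.ν i) (I.φV i) τ ∧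
          meanParam (I.baseF α) (I.stat α) θ = η.1 α ∧ meanParam (I.ν i) (I.φV i) τ = η.2 i := by
    intro η hη
    obtain ⟨θ, hθ, hθη⟩ := hη.1 α
    obtain ⟨τ, hτ, hmap, hmean⟩ := hI.exists_map_law_eq_meanParam_eq α i hθ
    exact ⟨θ, hθ, τ, hτ, hmap, hθη, hmean.trans (hθη ▸ funext (hη.2.2 α i))⟩
  refine .of_exists_support fun η hη => ?_
  obtain ⟨θ, hθ, τ, hτ, hmap, hθη, hτη⟩ := hparam η hη
  refine ⟨dotProductBilin ℝ ℝ θ ∘ₗ LinearMap.proj α ∘ₗ LinearMap.fst ℝ _ _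
    - dotProductBilin ℝ ℝ τ ∘ₗ LinearMap.proj i.1 ∘ₗ LinearMap.snd ℝ _ _, fun η' hη' => ?_⟩
  obtain ⟨θ', hθ', τ', hτ', hmap', hθη', hτη'⟩ := hparam η' hη'
  have hle := legendre_sub_tangent_le_of_map_law (measurable_pi_apply i) hθ' hθ hτ' hτ hmap' hmap
  rw [hθη, hτη, hθη', hτη'] at hle
  simp only [LinearMap.sub_apply, LinearMap.comp_apply, LinearMap.fst_apply, LinearMap.snd_apply,
    LinearMap.proj_apply, dotProductBilin_apply_apply, Prod.fst_sub, Prod.snd_sub, Pi.sub_apply]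
  linarith

theorem isConvexFunOn_legendre_hyperedge (hI : I.IsMarginallyClosed) (α : H.edges) :
    IsConvexFunOn I.L fun η => legendre (I.baseF α) (I.stat α) (η.1 α) := by
  have : NeZero (I.baseF α) := ⟨hI.baseF_ne_zero α⟩
  have h := (isConvexFunOn_legendre (ν := I.baseF α) (φ := I.stat α)).comp_linearMap
    (LinearMap.proj α ∘ₗ LinearMap.fst ℝ (∀ α, I.Idx α → ℝ) (∀ i, I.J i → ℝ))
  exact h.mono fun _ hη => hη.1 α

theorem isConvexFunOn_legendre_vertex (hI : I.IsMarginallyClosed) (i : V) :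
    IsConvexFunOn I.L fun η => legendre (I.ν i) (I.φV i) (η.2 i) := by
  have : NeZero (I.ν i) := ⟨hI.ne_zero i⟩
  have h := (isConvexFunOn_legendre (ν := I.ν i) (φ := I.φV i)).comp_linearMap
    (LinearMap.proj i ∘ₗ LinearMap.snd ℝ (∀ α, I.Idx α → ℝ) (∀ i, I.J i → ℝ))
  exact h.mono fun _ hη => hη.2.1 i

end IsMarginallyClosed

end LocalFamily

/-! ### Orientations of the bipartite graph -/

theorem exists_injOn_head_of_isTree {W : Type*} [Finite W] {T : SimpleGraph W} (hT : T.IsTree)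
    (r : W) :
    ∃ head : Sym2 W → W, Set.InjOn head T.edgeSet ∧ ∀ e ∈ T.edgeSet, head e ∈ e ∧ head e ≠ r := by
  have : Nonempty W := ⟨r⟩
  have hparent : ∀ w, ∃ p, w ≠ r → T.Adj w p ∧ T.dist r p < T.dist r w := by
    intro w
    obtain ⟨q, hq⟩ := hT.connected.exists_walk_length_eq_dist w r
    cases q with
    | nil => exact ⟨r, fun hw => absurd rfl hw⟩
    | cons hadj q =>
      refine ⟨_, fun _ => ⟨hadj, ?_⟩⟩
      rw [T.dist_comm, T.dist_comm (u := r), ← hq, SimpleGraph.Walk.length_cons]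
      exact Nat.lt_succ_of_le (SimpleGraph.dist_le q)
  choose p hp using hparent
  let edge : W → Sym2 W := fun w => s(w, p w)
  have hinj : Set.InjOn edge {r}ᶜ := by
    intro w hw w' hw' h
    obtain ⟨h, -⟩ | ⟨h, h'⟩ := Sym2.eq_iff.1 h
    · exact h
    · have hlt := h' ▸ (hp w hw).2
      exact absurd (h ▸ (hp w' hw').2) hlt.not_gt
  have himage : edge '' {r}ᶜ = T.edgeSet := by
    refine Set.eq_of_subset_of_ncard_le ?_ ?_
    · rintro _ ⟨w, hw, rfl⟩
      exact (hp w hw).1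
    · rw [hinj.ncard_image, Set.ncard_compl, Set.ncard_singleton,
        ← (SimpleGraph.isTree_iff_connected_and_card.1 hT).2, Nat.add_sub_cancel,
        Nat.card_coe_set_eq]
  refine ⟨Function.invFunOn edge {r}ᶜ, himage ▸ Function.invFunOn_injOn_image edge _,
    himage ▸ fun e he => ⟨?_, Function.invFunOn_mem he⟩⟩
  have hedge : edge (Function.invFunOn edge {r}ᶜ e) = e := Function.invFunOn_eq he
  have hmem : Function.invFunOn edge {r}ᶜ e ∈ edge (Function.invFunOn edge {r}ᶜ e) :=
    Sym2.mem_mk_left _ _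
  rwa [hedge] at hmem

theorem exists_injOn_head {W : Type*} [Finite W] {G : SimpleGraph W} (hG : G.Connected)
    (hcard : G.edgeSet.ncard ≤ Nat.card W) :
    ∃ head : Sym2 W → W, Set.InjOn head G.edgeSet ∧ ∀ e ∈ G.edgeSet, head e ∈ e := by
  classical
  obtain ⟨T, hTG, hT⟩ := hG.exists_isTree_le
  have hsub : T.edgeSet ⊆ G.edgeSet := SimpleGraph.edgeSet_mono hTG
  have hdiff : (G.edgeSet \ T.edgeSet).Subsingleton := by
    rw [← Set.ncard_le_one_iff_subsingleton, Set.ncard_sdiff hsub, ← Nat.card_coe_set_eq T.edgeSet]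
    have := (SimpleGraph.isTree_iff_connected_and_card.1 hT).2
    omega
  obtain ⟨r, hr⟩ : ∃ r : W, ∀ e ∈ G.edgeSet \ T.edgeSet, r ∈ e := by
    obtain hempty | ⟨e, he⟩ := (G.edgeSet \ T.edgeSet).eq_empty_or_nonempty
    · exact ⟨hG.nonempty.some, by simp [hempty]⟩
    · exact ⟨e.out.1, fun e' he' => hdiff he he' ▸ Sym2.out_fst_mem e⟩
  obtain ⟨head, hinj, hhead⟩ := exists_injOn_head_of_isTree hT r
  refine ⟨T.edgeSet.piecewise head fun _ => r, ?_, fun e he => ?_⟩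
  · rw [← Set.union_sdiff_cancel hsub, Set.injOn_union Set.disjoint_sdiff_right]
    refine ⟨hinj.congr (Set.piecewise_eqOn ..).symm, hdiff.injOn _, fun e he e' he' => ?_⟩
    rw [Set.piecewise_eq_of_mem _ _ _ he, Set.piecewise_eq_of_notMem _ _ _ he'.2]
    exact (hhead e he).2
  · by_cases heT : e ∈ T.edgeSet
    · rw [Set.piecewise_eq_of_mem _ _ _ heT]
      exact (hhead e heT).1
    · rw [Set.piecewise_eq_of_notMem _ _ _ heT]
      exact hr e ⟨he, heT⟩

namespace FinHypergraph

variable {V : Type*} {H : FinHypergraph V}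

/-- The edge of the bipartite graph that belongs to the incidence `p.2 ∈ p.1`. -/
def incidenceEdge (p : Σ α : H.edges, α.1) : Sym2 (V ⊕ H.edges) := s(Sum.inl p.2.1, Sum.inr p.1)

theorem incidenceEdge_injective : Function.Injective (incidenceEdge (H := H)) := by
  rintro ⟨α, i, hi⟩ ⟨β, j, hj⟩ h
  simp only [incidenceEdge, Sym2.eq_iff, Sum.inl.injEq, Sum.inr.injEq, reduceCtorEq, and_self,
    or_false] at h
  obtain ⟨rfl, rfl⟩ := h
  rfl

theorem edgeSet_bipartite : H.bipartite.edgeSet = Set.range (incidenceEdge (H := H)) := by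
  ext e
  induction e using Sym2.ind with
  | _ a b =>
    rw [SimpleGraph.mem_edgeSet, bipartite, SimpleGraph.fromRel_adj]
    constructor
    · rintro ⟨-, ⟨i, α, rfl, rfl, hi⟩ | ⟨i, α, rfl, rfl, hi⟩⟩
      · exact ⟨⟨α, i, hi⟩, rfl⟩
      · exact ⟨⟨α, i, hi⟩, Sym2.eq_swap⟩
    · rintro ⟨⟨α, i⟩, h⟩
      obtain ⟨rfl, rfl⟩ | ⟨rfl, rfl⟩ := Sym2.eq_iff.1 h
      · exact ⟨Sum.inl_ne_inr, .inl ⟨i, α, rfl, rfl, i.2⟩⟩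
      · exact ⟨Sum.inr_ne_inl, .inr ⟨i, α, rfl, rfl, i.2⟩⟩

theorem card_incidences : Nat.card (Σ α : H.edges, α.1) = H.numIncidences := by
  rw [Nat.card_sigma, numIncidences]
  simp only [Nat.card_eq_fintype_card, Fintype.card_coe]
  exact Finset.sum_coe_sort H.edges Finset.card

theorem ncard_edgeSet_bipartite : H.bipartite.edgeSet.ncard = H.numIncidences := by
  rw [edgeSet_bipartite, ← Set.image_univ, Set.ncard_image_of_injective _ incidenceEdge_injective,
    Set.ncard_univ, card_incidences]

variable [Fintype V]

theorem nullity_eq_of_connected (hH : H.Connected) :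
    H.nullity = (H.numIncidences : ℤ) - (Fintype.card V + H.edges.card) + 1 := by
  have := hH.preconnected.subsingleton_connectedComponent
  have := hH.nonempty.map H.bipartite.connectedComponentMk
  rw [nullity, numComponents, Nat.card_unique, Nat.cast_one]

theorem nullity_nonneg_of_connected (hH : H.Connected) : 0 ≤ H.nullity := by
  have h := SimpleGraph.Connected.card_vert_le_card_edgeSet_add_one hH
  rw [Nat.card_coe_set_eq, ncard_edgeSet_bipartite, Nat.card_sum, Nat.card_eq_fintype_card,
    Nat.card_eq_fintype_card, Fintype.card_coe] at h
  rw [nullity_eq_of_connected hH]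
  omega

theorem exists_injOn_incidences (hH : H.Connected) (h : H.nullity ≤ 1) :
    ∃ M : Set (Σ α : H.edges, α.1),
      Set.InjOn Sigma.fst M ∧ Set.InjOn (fun p : Σ α : H.edges, α.1 => (p.2 : V)) Mᶜ := by
  have hcard : H.bipartite.edgeSet.ncard ≤ Nat.card (V ⊕ H.edges) := by
    rw [nullity_eq_of_connected hH] at h
    rw [ncard_edgeSet_bipartite, Nat.card_sum, Nat.card_eq_fintype_card,
      Nat.card_eq_fintype_card, Fintype.card_coe]
    omega
  obtain ⟨head, hinj, hmem⟩ := exists_injOn_head hH hcard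
  rw [edgeSet_bipartite] at hinj hmem
  have hhead : Function.Injective fun p => head (incidenceEdge (H := H) p) := fun p q hpq =>
    incidenceEdge_injective (hinj (Set.mem_range_self p) (Set.mem_range_self q) hpq)
  refine ⟨{p | head (incidenceEdge p) = Sum.inr p.1}, fun p hp q hq hpq => ?_,
    fun p hp q hq hpq => ?_⟩
  · exact hhead (Eq.trans hp (hpq ▸ Eq.symm hq))
  · have hp' := (Sym2.mem_iff.1 (hmem _ (Set.mem_range_self p))).resolve_right hp
    have hq' := (Sym2.mem_iff.1 (hmem _ (Set.mem_range_self q))).resolve_right hq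
    exact hhead (hp'.trans ((congrArg Sum.inl hpq).trans hq'.symm))

variable [DecidableEq V]

theorem sum_degree_mul (b : V → ℝ) :
    ∑ i, (H.degree i : ℝ) * b i = ∑ p : Σ α : H.edges, α.1, b p.2 := by
  simp only [Fintype.sum_sigma, Finset.sum_coe_sort _ b, degree, Finset.natCast_card_filter,
    Finset.sum_mul]
  rw [Finset.sum_comm, ← Finset.sum_coe_sort]
  simp

theorem card_add_sum_one_sub_degree (hH : H.Connected) :
    (H.edges.card : ℝ) + ∑ i, (1 - (H.degree i : ℝ)) = 1 - H.nullity := by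
  have hsum := sum_degree_mul (H := H) 1
  simp only [Pi.one_apply, mul_one, Finset.sum_const, Finset.card_univ, ← Nat.card_eq_fintype_card,
    card_incidences] at hsum
  rw [nullity_eq_of_connected hH, Finset.sum_sub_distrib, hsum]
  simp only [Finset.sum_const, Finset.card_univ, nsmul_eq_mul, mul_one]
  push_cast
  ring

theorem exists_sum_add_sum_one_sub_degree_mul_eq (hH : H.Connected) (h : H.nullity ≤ 1) :
    ∃ (S : Finset H.edges) (M : Finset (Σ α : H.edges, α.1)) (T : Finset V),
      ∀ (a : H.edges → ℝ) (b : V → ℝ), ∑ α, a α + ∑ i, (1 - (H.degree i : ℝ)) * b i =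
        ∑ α ∈ S, a α + ∑ p ∈ M, (a p.1 - b p.2) + ∑ i ∈ T, b i := by
  classical
  obtain ⟨M, hM, hMc⟩ := exists_injOn_incidences hH h
  lift M to Finset (Σ α : H.edges, α.1) using M.toFinite
  rw [← Finset.coe_compl] at hMc
  refine ⟨(M.image Sigma.fst)ᶜ, M, (Mᶜ.image fun p => (p.2 : V))ᶜ, fun a b => ?_⟩
  have ha := Finset.sum_compl_add_sum (M.image Sigma.fst) a
  have hb := Finset.sum_compl_add_sum (Mᶜ.image fun p => (p.2 : V)) b
  have hdeg := Finset.sum_add_sum_compl M fun p => b p.2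
  rw [Finset.sum_image hM] at ha
  rw [Finset.sum_image hMc] at hb
  simp only [sub_mul, one_mul, Finset.sum_sub_distrib, sum_degree_mul]
  linarith

end FinHypergraph

namespace LocalFamily

variable {V : Type u} [Fintype V] [DecidableEq V] {H : FinHypergraph V} {X : V → Type v}
  [∀ i, MeasurableSpace (X i)] {I : LocalFamily.{u, v, w₁, w₂} H X}

theorem IsMarginallyClosed.isConvexFunOn_bethe (hI : I.IsMarginallyClosed) (hH : H.Connected)
    (h : H.nullity ≤ 1) (θbar : ∀ α : H.edges, I.Idx α → ℝ) :
    IsConvexFunOn I.L (I.bethe θbar) := by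
  obtain ⟨S, M, T, hregroup⟩ := FinHypergraph.exists_sum_add_sum_one_sub_degree_mul_eq hH h
  have hlinear : IsConvexFunOn I.L fun η => -∑ α, ∑ k, θbar α k * η.1 α k := by
    have := IsConvexFunOn.linearMap (S := I.L) (-∑ α, dotProductBilin ℝ ℝ (θbar α) ∘ₗ
      LinearMap.proj α ∘ₗ LinearMap.fst ℝ (∀ α, I.Idx α → ℝ) (∀ i, I.J i → ℝ))
    convert this using 2 with η
    simp [dotProduct]
  have hrest := ((IsConvexFunOn.finsetSum fun α (_ : α ∈ S) =>
    hI.isConvexFunOn_legendre_hyperedge α).add (.finsetSum fun p (_ : p ∈ M) =>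
      hI.isConvexFunOn_legendre_sub p.1 p.2)).add (.finsetSum fun i (_ : i ∈ T) =>
        hI.isConvexFunOn_legendre_vertex i)
  convert hlinear.add hrest using 2 with η
  rw [bethe, add_assoc, hregroup (fun α => ExpFamily.legendre (I.baseF α) (I.stat α) (η.1 α))
    fun i => ExpFamily.legendre (I.ν i) (I.φV i) (η.2 i)]

end LocalFamily

/-! ### Midpoint gaps -/

/-- The excess of `f` at the midpoint of `x` and `y` over the mean of its values at `x` and `y`;
it is at most `0` for convex `f`. -/
def midpointGap {E : Type*} [AddCommGroup E] [Module ℝ E] (f : E → ℝ) (x y : E) : ℝ :=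
  f (midpoint ℝ x y) - (f x + f y) / 2

theorem IsConvexFunOn.midpointGap_nonpos {E : Type*} [AddCommGroup E] [Module ℝ E] {S : Set E}
    {f : E → ℝ} (h : IsConvexFunOn S f) {x y : E} (hxy : segment ℝ x y ⊆ S) :
    midpointGap f x y ≤ 0 := by
  have hmid := (h _ hxy (convex_segment x y)).2 (left_mem_segment ℝ x y) (right_mem_segment ℝ x y)
    (inv_nonneg.2 zero_le_two) (inv_nonneg.2 zero_le_two) (by norm_num : (2⁻¹ + 2⁻¹ : ℝ) = 1)
  rw [← smul_add, ← invOf_eq_inv, ← midpoint_eq_smul_add] at hmid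
  simp only [smul_eq_mul, invOf_eq_inv] at hmid
  rw [midpointGap]
  linarith

namespace LocalFamily

variable {V : Type u} {H : FinHypergraph V} {X : V → Type v} [∀ i, MeasurableSpace (X i)]
  {I : LocalFamily.{u, v, w₁, w₂} H X}

theorem segment_subset_L {x y : I.Params}
    (hF : ∀ α, segment ℝ (x.1 α) (y.1 α) ⊆ ExpFamily.meanDomain (I.baseF α) (I.stat α))
    (hV : ∀ i, segment ℝ (x.2 i) (y.2 i) ⊆ ExpFamily.meanDomain (I.ν i) (I.φV i))
    (hx : ∀ (α : H.edges) (i : α.1) (j : I.J i), x.1 α (Sum.inr ⟨i, j⟩) = x.2 i j)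
    (hy : ∀ (α : H.edges) (i : α.1) (j : I.J i), y.1 α (Sum.inr ⟨i, j⟩) = y.2 i j) :
    segment ℝ x y ⊆ I.L := by
  rintro _ ⟨a, b, ha, hb, hab, rfl⟩
  exact ⟨fun α => hF α ⟨a, b, ha, hb, hab, rfl⟩, fun i => hV i ⟨a, b, ha, hb, hab, rfl⟩,
    fun α i j => by simp [hx, hy]⟩

variable [Fintype V] [DecidableEq V]

theorem midpointGap_bethe (θbar : ∀ α : H.edges, I.Idx α → ℝ) (x y : I.Params) :
    midpointGap (I.bethe θbar) x y =
      ∑ α, midpointGap (ExpFamily.legendre (I.baseF α) (I.stat α)) (x.1 α) (y.1 α) +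
        ∑ i, (1 - (H.degree i : ℝ)) *
          midpointGap (ExpFamily.legendre (I.ν i) (I.φV i)) (x.2 i) (y.2 i) := by
  have hlinear : ∑ α, ∑ k, θbar α k * (midpoint ℝ x y).1 α k =
      (∑ α, ∑ k, θbar α k * x.1 α k + ∑ α, ∑ k, θbar α k * y.1 α k) / 2 := by
    simp only [← Finset.sum_add_distrib, Finset.sum_div, midpoint_eq_smul_add, Prod.smul_fst,
      Prod.fst_add, Pi.smul_apply, Pi.add_apply, smul_eq_mul, invOf_eq_inv]
    refine Finset.sum_congr rfl fun α _ => Finset.sum_congr rfl fun k _ => ?_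
    ring
  have hF : ∀ α, (midpoint ℝ x y).1 α = midpoint ℝ (x.1 α) (y.1 α) := fun α => by
    simp [midpoint_eq_smul_add]
  have hV : ∀ i, (midpoint ℝ x y).2 i = midpoint ℝ (x.2 i) (y.2 i) := fun i => by
    simp [midpoint_eq_smul_add]
  rw [midpointGap, bethe, hlinear]
  simp only [midpointGap, bethe, hF, hV, mul_sub, mul_add, add_div, mul_div_assoc',
    Finset.sum_sub_distrib, Finset.sum_add_distrib, ← Finset.sum_div]
  ring

theorem nullity_le_one_of_tendsto_midpointGap (hH : H.Connected)
    {θbar : ∀ α : H.edges, I.Idx α → ℝ} (h : IsConvexFunOn I.L (I.bethe θbar))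
    {κ : Type*} {l : Filter κ} [l.NeBot] {x y : κ → I.Params}
    (hL : ∀ᶠ δ in l, segment ℝ (x δ) (y δ) ⊆ I.L) {c : ℝ} (hc : c < 0)
    (hF : ∀ α, Tendsto (fun δ => midpointGap (ExpFamily.legendre (I.baseF α) (I.stat α))
      ((x δ).1 α) ((y δ).1 α)) l (𝓝 c))
    (hV : ∀ i, Tendsto (fun δ => midpointGap (ExpFamily.legendre (I.ν i) (I.φV i))
      ((x δ).2 i) ((y δ).2 i)) l (𝓝 c)) :
    H.nullity ≤ 1 := by
  have hlim := (tendsto_finsetSum Finset.univ fun α _ => hF α).add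
    (tendsto_finsetSum Finset.univ fun i _ => (hV i).const_mul (1 - (H.degree i : ℝ)))
  simp only [← midpointGap_bethe θbar] at hlim
  have hle := le_of_tendsto hlim (hL.mono fun δ hδ => h.midpointGap_nonpos hδ)
  rw [← Finset.sum_mul, Finset.sum_const, Finset.card_univ, Fintype.card_coe, nsmul_eq_mul,
    ← add_mul, FinHypergraph.card_add_sum_one_sub_degree hH] at hle
  have hnullity : (0 : ℝ) ≤ 1 - H.nullity := nonneg_of_mul_nonpos_left hle hc
  exact_mod_cast sub_nonneg.1 hnullity

end LocalFamily

/-! ### Multinomial families -/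

open Finset BigOperators in
theorem expect_comp_eval {κ : Type*} [Fintype κ] [DecidableEq κ] {Y : κ → Type*}
    [∀ i, Fintype (Y i)] [∀ i, Nonempty (Y i)] (i : κ) (f : Y i → ℝ) :
    𝔼 x : ∀ i, Y i, f (x i) = 𝔼 y, f y := by
  refine (Fintype.expect_equiv (Equiv.piSplitAt i Y) _ (fun p => f p.1) fun _ => rfl).trans ?_
  rw [← univ_product_univ, expect_product]
  simp

/-- The interior of the standard simplex: the everywhere positive probability weights on `Ω`. -/
def openSimplex (Ω : Type*) [Fintype Ω] : Set (Ω → ℝ) :=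
  {P | (∀ x, 0 < P x) ∧ ∑ x, P x = 1}

theorem convex_openSimplex (Ω : Type*) [Fintype Ω] : Convex ℝ (openSimplex Ω) := by
  intro P hP Q hQ a b ha hb hab
  refine ⟨fun x => convex_Ioi (0 : ℝ) (hP.1 x) (hQ.1 x) ha hb hab, ?_⟩
  simp [Finset.sum_add_distrib, ← Finset.mul_sum, hP.2, hQ.2, hab]

/-- The probability weights that put mass `1 - δ` on `a` and spread the remaining mass `δ`
uniformly. -/
def smoothedPointMass {Ω : Type*} [Fintype Ω] [DecidableEq Ω] (a : Ω) (δ : ℝ) : Ω → ℝ :=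
  (1 - δ) • Pi.single a 1 + fun _ => δ / Fintype.card Ω

section SmoothedPointMass

variable {Ω : Type*} [Fintype Ω] [DecidableEq Ω]

open Finset BigOperators in
theorem sum_smoothedPointMass_mul (a : Ω) (δ : ℝ) (f : Ω → ℝ) :
    ∑ x, smoothedPointMass a δ x * f x = (1 - δ) * f a + δ * 𝔼 x, f x := by
  simp only [smoothedPointMass, Pi.add_apply, Pi.smul_apply, Pi.single_apply, smul_eq_mul,
    add_mul, mul_ite, ite_mul, mul_one, mul_zero, zero_mul, sum_add_distrib, sum_ite_eq', mem_univ,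
    if_true, ← mul_sum, Fintype.expect_eq_sum_div_card]
  ring

theorem smoothedPointMass_mem_openSimplex (a : Ω) {δ : ℝ} (hδ : δ ∈ Set.Ioo (0 : ℝ) 1) :
    smoothedPointMass a δ ∈ openSimplex Ω := by
  have : Nonempty Ω := ⟨a⟩
  refine ⟨fun x => ?_, ?_⟩
  · have hsingle : 0 ≤ Pi.single (M := fun _ => ℝ) a 1 x := by
      by_cases h : x = a <;> simp [h]
    have := mul_nonneg (sub_nonneg.2 hδ.2.le) hsingle
    have := hδ.1
    simp only [smoothedPointMass, Pi.add_apply, Pi.smul_apply, smul_eq_mul]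
    positivity
  · simpa using sum_smoothedPointMass_mul a δ 1

theorem tendsto_midpointGap_smoothedPointMass {a b : Ω} (hab : a ≠ b) :
    Tendsto (fun δ => midpointGap (fun P : Ω → ℝ => -∑ x, Real.negMulLog (P x))
      (smoothedPointMass a δ) (smoothedPointMass b δ)) (𝓝[>] 0) (𝓝 (-Real.log 2)) := by
  refine (Continuous.tendsto' ?_ 0 _ ?_).mono_left nhdsWithin_le_nhds
  · unfold midpointGap smoothedPointMass
    simp only [midpoint_eq_smul_add]
    fun_prop
  · have hpoint : ∀ c : Ω, ∑ x, Real.negMulLog (smoothedPointMass c 0 x) = 0 := fun c =>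
      Finset.sum_eq_zero fun x _ => by
        by_cases h : x = c <;> simp [smoothedPointMass, h]
    have hmid : ∑ x, Real.negMulLog (midpoint ℝ (smoothedPointMass a 0) (smoothedPointMass b 0) x) =
        Real.log 2 := by
      rw [Fintype.sum_eq_add a b hab fun x hx => by
        simp [smoothedPointMass, hx.1, hx.2]]
      have ha : midpoint ℝ (smoothedPointMass a 0) (smoothedPointMass b 0) a = 2⁻¹ := by
        simp [smoothedPointMass, midpoint_eq_smul_add, hab]
      have hb : midpoint ℝ (smoothedPointMass a 0) (smoothedPointMass b 0) b = 2⁻¹ := by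
        simp [smoothedPointMass, midpoint_eq_smul_add, hab.symm]
      rw [ha, hb, Real.negMulLog, Real.log_inv]
      ring
    simp only [midpointGap, hpoint, hmid]
    simp

end SmoothedPointMass

/-- Every point of `Ω` has the same mass `w > 0` under `ν`: a multiple of the counting measure,
described through the real mass of points. -/
structure HasUniformMass {Ω : Type*} [MeasurableSpace Ω] (ν : Measure Ω) (w : ℝ) : Prop where
  pos : 0 < w
  real_singleton : ∀ x, ν.real {x} = w

namespace HasUniformMass

theorem isFiniteMeasure {Ω : Type*} [MeasurableSpace Ω] [Finite Ω] {ν : Measure Ω} {w : ℝ}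
    (hν : HasUniformMass ν w) : IsFiniteMeasure ν := by
  refine ⟨?_⟩
  rw [← Set.biUnion_of_singleton Set.univ]
  refine measure_biUnion_lt_top Set.finite_univ fun x _ => lt_top_iff_ne_top.2 fun htop => ?_
  exact hν.pos.ne (by simpa [Measure.real, htop] using hν.real_singleton x)

theorem neZero {Ω : Type*} [MeasurableSpace Ω] [Nonempty Ω] {ν : Measure Ω} {w : ℝ}
    (hν : HasUniformMass ν w) : NeZero ν := by
  refine ⟨fun h0 => hν.pos.ne ?_⟩
  simpa [h0] using hν.real_singleton (Classical.arbitrary Ω)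

theorem pi {κ : Type*} [Fintype κ] {Y : κ → Type*} [∀ i, MeasurableSpace (Y i)]
    {ν : ∀ i, Measure (Y i)} [∀ i, SigmaFinite (ν i)] {w : κ → ℝ}
    (hν : ∀ i, HasUniformMass (ν i) (w i)) : HasUniformMass (Measure.pi ν) (∏ i, w i) where
  pos := Finset.prod_pos fun i _ => (hν i).pos
  real_singleton x := by
    simp only [Measure.real, Measure.pi_singleton, ENNReal.toReal_prod]
    exact Finset.prod_congr rfl fun i _ => (hν i).real_singleton (x i)

end HasUniformMass

namespace ExpFamily

variable {Ω ι : Type*} [MeasurableSpace Ω] [MeasurableSingletonClass Ω] [Fintype Ω] [Fintype ι]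
  {ν : Measure Ω} {φ : Ω → ι → ℝ} {w : ℝ} {P Q : Ω → ℝ}

theorem IsAllPositiveDensities.exists_density_eq (h : IsAllPositiveDensities ν φ)
    (hν : HasUniformMass ν w) (hP : P ∈ openSimplex Ω) :
    ∃ θ ∈ natDomain ν φ, ∀ x, density ν φ θ x = P x / w := by
  have := hν.isFiniteMeasure
  have hmem : (fun x => P x / w) ∈ {p : Ω → ℝ | (∀ x, 0 < p x) ∧ ∫ x, p x ∂ν = 1} := by
    refine ⟨fun x => div_pos (hP.1 x) hν.pos, ?_⟩
    rw [integral_fintype .of_finite]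
    simp [hν.real_singleton, mul_div_cancel₀ _ hν.pos.ne', hP.2]
  obtain ⟨θ, hθ, hdensity⟩ := h.symm.subset hmem
  exact ⟨θ, hθ, fun x => (congrFun hdensity x).symm⟩

theorem integral_law_eq_sum (hν : HasUniformMass ν w) {θ : ι → ℝ}
    (hP : ∀ x, density ν φ θ x = P x / w) (f : Ω → ℝ) :
    ∫ x, f x ∂law ν φ θ = ∑ x, P x * f x := by
  have := hν.isFiniteMeasure
  have hw := hν.pos.ne'
  rw [law, integral_withDensity_eq_integral_toReal_smul (measurable_of_finite _) (by simp),
    integral_fintype .of_finite]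
  refine Finset.sum_congr rfl fun x _ => ?_
  rw [hν.real_singleton, ENNReal.toReal_ofReal (show 0 ≤ density ν φ θ x from (Real.exp_pos _).le),
    hP, smul_eq_mul, smul_eq_mul]
  field_simp

theorem IsAllPositiveDensities.vecMul_mem_meanDomain (h : IsAllPositiveDensities ν φ)
    (hν : HasUniformMass ν w) (hP : P ∈ openSimplex Ω) :
    Matrix.vecMul P (.of φ) ∈ meanDomain ν φ := by
  obtain ⟨θ, hθ, hdensity⟩ := h.exists_density_eq hν hP
  exact ⟨θ, hθ, funext fun j => integral_law_eq_sum hν hdensity _⟩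

theorem IsAllPositiveDensities.segment_subset_meanDomain (h : IsAllPositiveDensities ν φ)
    (hν : HasUniformMass ν w) (hP : P ∈ openSimplex Ω) (hQ : Q ∈ openSimplex Ω) :
    segment ℝ (Matrix.vecMul P (.of φ)) (Matrix.vecMul Q (.of φ)) ⊆ meanDomain ν φ := by
  rintro _ ⟨a, b, ha, hb, hab, rfl⟩
  rw [← Matrix.smul_vecMul, ← Matrix.smul_vecMul, ← Matrix.add_vecMul]
  exact h.vecMul_mem_meanDomain hν (convex_openSimplex Ω hP hQ ha hb hab)

variable [Nonempty Ω]

theorem IsAllPositiveDensities.legendre_vecMul (h : IsAllPositiveDensities ν φ)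
    (hν : HasUniformMass ν w) (hP : P ∈ openSimplex Ω) :
    legendre ν φ (Matrix.vecMul P (.of φ)) = -∑ x, Real.negMulLog (P x) - Real.log w := by
  have := hν.neZero
  obtain ⟨θ, hθ, hdensity⟩ := h.exists_density_eq hν hP
  have hmean : meanParam ν φ θ = Matrix.vecMul P (.of φ) :=
    funext fun j => integral_law_eq_sum hν hdensity _
  rw [← hmean, legendre_meanParam_eq_integral_log_density hθ, integral_law_eq_sum hν hdensity]
  simp only [hdensity, Real.log_div (hP.1 _).ne' hν.pos.ne', mul_sub, Finset.sum_sub_distrib,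
    ← Finset.sum_mul, hP.2, one_mul, Real.negMulLog, neg_mul, Finset.sum_neg_distrib, neg_neg]

theorem IsAllPositiveDensities.midpointGap_legendre (h : IsAllPositiveDensities ν φ)
    (hν : HasUniformMass ν w) (hP : P ∈ openSimplex Ω) (hQ : Q ∈ openSimplex Ω) :
    midpointGap (legendre ν φ) (Matrix.vecMul P (.of φ)) (Matrix.vecMul Q (.of φ)) =
      midpointGap (fun P => -∑ x, Real.negMulLog (P x)) P Q := by
  have hmid : midpoint ℝ (Matrix.vecMul P (.of φ)) (Matrix.vecMul Q (.of φ)) =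
      Matrix.vecMul (midpoint ℝ P Q) (.of φ) := by
    simp [midpoint_eq_smul_add, Matrix.add_vecMul, Matrix.smul_vecMul]
  rw [midpointGap, hmid, h.legendre_vecMul hν hP, h.legendre_vecMul hν hQ,
    h.legendre_vecMul hν ((convex_openSimplex Ω).midpoint_mem hP hQ), midpointGap]
  ring

theorem IsAllPositiveDensities.tendsto_midpointGap_legendre [DecidableEq Ω]
    (h : IsAllPositiveDensities ν φ) (hν : HasUniformMass ν w) {a b : Ω} (hab : a ≠ b) :
    Tendsto (fun δ => midpointGap (legendre ν φ) (Matrix.vecMul (smoothedPointMass a δ) (.of φ))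
      (Matrix.vecMul (smoothedPointMass b δ) (.of φ))) (𝓝[>] 0) (𝓝 (-Real.log 2)) := by
  refine (tendsto_midpointGap_smoothedPointMass hab).congr' ?_
  filter_upwards [Ioo_mem_nhdsGT zero_lt_one] with δ hδ
  exact (h.midpointGap_legendre hν (smoothedPointMass_mem_openSimplex a hδ)
    (smoothedPointMass_mem_openSimplex b hδ)).symm

end ExpFamily

namespace LocalFamily

variable {V : Type u} {H : FinHypergraph V} {X : V → Type v} [∀ i, MeasurableSpace (X i)]
  {I : LocalFamily.{u, v, w₁, w₂} H X}

section SmoothedPointMassParams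

variable [DecidableEq V] [∀ i, Fintype (X i)] [∀ i, DecidableEq (X i)]

/-- The pseudomarginals of the law on `∏ i, X i` that puts mass `1 - δ` on `z` and spreads the
remaining mass uniformly: all its marginals are of the same form. -/
def smoothedPointMassParams (I : LocalFamily.{u, v, w₁, w₂} H X) (z : ∀ i, X i) (δ : ℝ) :
    I.Params :=
  (fun α => Matrix.vecMul (smoothedPointMass (fun i : α.1 => z i) δ) (.of (I.stat α)),
    fun i => Matrix.vecMul (smoothedPointMass (z i) δ) (.of (I.φV i)))

theorem smoothedPointMassParams_consistent (z : ∀ i, X i) (δ : ℝ) (α : H.edges) (i : α.1)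
    (j : I.J i) : (I.smoothedPointMassParams z δ).1 α (Sum.inr ⟨i, j⟩) =
      (I.smoothedPointMassParams z δ).2 i j := by
  have : ∀ i, Nonempty (X i) := fun i => ⟨z i⟩
  refine (sum_smoothedPointMass_mul (fun i : α.1 => z i) δ fun x => I.φV i (x i) j).trans ?_
  rw [expect_comp_eval (Y := fun i : α.1 => X i) i fun y => I.φV i y j]
  exact (sum_smoothedPointMass_mul (z i) δ fun y => I.φV i y j).symm

end SmoothedPointMassParams

variable [∀ i, MeasurableSingletonClass (X i)]

theorem IsMultinomial.exists_hasUniformMass (hI : I.IsMultinomial) (i : V) :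
    ∃ w, HasUniformMass (I.ν i) w := by
  obtain ⟨c, hc₀, hc_top, hc⟩ := hI.uniform i
  exact ⟨c.toReal, ENNReal.toReal_pos hc₀ hc_top, fun x => by simp [hc, Measure.real]⟩

theorem IsMultinomial.nullity_le_one [Fintype V] [DecidableEq V] [∀ i, Finite (X i)]
    [∀ i, Nontrivial (X i)] (hI : I.IsMultinomial) (hH : H.Connected)
    {θbar : ∀ α : H.edges, I.Idx α → ℝ} (h : IsConvexFunOn I.L (I.bethe θbar)) :
    H.nullity ≤ 1 := by
  classical
  have := fun i => Fintype.ofFinite (X i)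
  choose w hν using hI.exists_hasUniformMass
  have : ∀ i, IsFiniteMeasure (I.ν i) := fun i => (hν i).isFiniteMeasure
  have hνF : ∀ α, HasUniformMass (I.baseF α) (∏ i : α.1, w i) := fun α =>
    .pi fun i : α.1 => hν i
  choose a b hab using fun i => exists_pair_ne (X i)
  have hrestrict : ∀ α : H.edges, (fun i : α.1 => a i) ≠ fun i : α.1 => b i := fun α heq => by
    obtain ⟨i, hi⟩ := H.nonempty_of_mem α.1 α.2
    exact hab i (congrFun heq ⟨i, hi⟩)
  refine nullity_le_one_of_tendsto_midpointGap hH h (x := I.smoothedPointMassParams a)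
    (y := I.smoothedPointMassParams b) ?_ (neg_neg_of_pos (Real.log_pos one_lt_two))
    (fun α => (hI.hyperedge α).tendsto_midpointGap_legendre (hνF α) (hrestrict α))
    fun i => (hI.vertex i).tendsto_midpointGap_legendre (hν i) (hab i)
  filter_upwards [Ioo_mem_nhdsGT zero_lt_one] with δ hδ
  exact segment_subset_L
    (fun α => (hI.hyperedge α).segment_subset_meanDomain (hνF α)
      (smoothedPointMass_mem_openSimplex _ hδ) (smoothedPointMass_mem_openSimplex _ hδ))
    (fun i => (hI.vertex i).segment_subset_meanDomain (hν i)
      (smoothedPointMass_mem_openSimplex _ hδ) (smoothedPointMass_mem_openSimplex _ hδ))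
    (smoothedPointMassParams_consistent a δ) (smoothedPointMassParams_consistent b δ)

end LocalFamily

/-! ### Gaussian families -/

theorem map_withDensity_comp {Ω Ω' : Type*} [MeasurableSpace Ω] [MeasurableSpace Ω']
    (μ : Measure Ω) {T : Ω → Ω'} (hT : Measurable T) {g : Ω' → ENNReal} (hg : Measurable g) :
    (μ.withDensity (g ∘ T)).map T = (μ.map T).withDensity g := by
  ext s hs
  rw [Measure.map_apply hT hs, withDensity_apply _ (hT hs), withDensity_apply _ hs,
    setLIntegral_map hs hg hT]
  rfl

theorem pi_withDensity_ofReal {κ : Type*} [Fintype κ] {Y : κ → Type*} [∀ i, MeasurableSpace (Y i)]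
    {μ : ∀ i, Measure (Y i)} [∀ i, SigmaFinite (μ i)] {g : ∀ i, Y i → ℝ} (hg₀ : ∀ i x, 0 ≤ g i x)
    (hg : ∀ i, Integrable (g i) (μ i)) :
    Measure.pi (fun i => (μ i).withDensity fun x => ENNReal.ofReal (g i x)) =
      (Measure.pi μ).withDensity fun x => ENNReal.ofReal (∏ i, g i (x i)) := by
  have : ∀ i, SigmaFinite ((μ i).withDensity fun x => ENNReal.ofReal (g i x)) := fun i =>
    have := isFiniteMeasure_withDensity_ofReal (hg i).2
    inferInstance
  refine Measure.pi_eq fun s hs => ?_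
  rw [withDensity_apply _ (.univ_pi hs), Measure.restrict_pi_pi,
    ← ofReal_integral_eq_lintegral_ofReal (.fintype_prod_dep fun i => (hg i).restrict)
      (.of_forall fun x => Finset.prod_nonneg fun i _ => hg₀ i (x i)),
    integral_fintype_prod_eq_prod, ENNReal.ofReal_prod_of_nonneg fun i _ =>
      integral_nonneg (hg₀ i)]
  refine Finset.prod_congr rfl fun i _ => ?_
  rw [withDensity_apply _ (hs i), ← ofReal_integral_eq_lintegral_ofReal (hg i).restrict
    (.of_forall (hg₀ i))]

section GaussianDensity

open Matrix

variable {κ : Type*} [Fintype κ]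

theorem pi_gaussianReal_eq_withDensity :
    Measure.pi (fun _ : κ => gaussianReal 0 1) = volume.withDensity fun y => ENNReal.ofReal
      (Real.exp (-(y ⬝ᵥ y) / 2) / √((2 * Real.pi) ^ Fintype.card κ)) := by
  simp only [gaussianReal_of_var_ne_zero 0 one_ne_zero, gaussianPDF_def]
  rw [pi_withDensity_ofReal (fun _ => gaussianPDFReal_nonneg 0 1)
    fun _ => integrable_gaussianPDFReal 0 1, ← volume_pi]
  have hsqrt : √((2 * Real.pi) ^ Fintype.card κ) = √(2 * Real.pi) ^ Fintype.card κ :=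
    (Real.sqrt_eq_iff_mul_self_eq (by positivity) (by positivity)).2 (by
      rw [← mul_pow, Real.mul_self_sqrt Real.two_pi_pos.le])
  congr with y
  simp only [gaussianPDFReal_def, NNReal.coe_one, mul_one, sub_zero, Finset.prod_mul_distrib,
    Finset.prod_const, Finset.card_univ, ← Real.exp_sum, inv_pow, hsqrt,
    dotProduct, pow_two, div_eq_inv_mul, ← Finset.mul_sum, Finset.sum_neg_distrib]

variable [DecidableEq κ]

theorem map_mulVec_add_volume {B : Matrix κ κ ℝ} (hB : B.det ≠ 0) (m : κ → ℝ) :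
    volume.map (fun y => B *ᵥ y + m) = ENNReal.ofReal |B.det⁻¹| • volume := by
  calc volume.map (fun y => B *ᵥ y + m) = (volume.map (toLin' B)).map (· + m) := by
        rw [Measure.map_map (by fun_prop) (toLin' B).continuous_of_finiteDimensional.measurable]
        rfl
    _ = ENNReal.ofReal |B.det⁻¹| • volume := by
        rw [Real.map_matrix_volume_pi_eq_smul_volume_pi hB, Measure.map_smul,
          map_add_right_eq_self]

theorem map_mulVec_add_pi_gaussianReal {B : Matrix κ κ ℝ} (hB : B.det ≠ 0) (m : κ → ℝ) :
    (Measure.pi fun _ => gaussianReal 0 1).map (fun y => B *ᵥ y + m) =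
      volume.withDensity fun x => ENNReal.ofReal
        (Real.exp (-((x - m) ⬝ᵥ (B * Bᵀ)⁻¹ *ᵥ (x - m)) / 2) /
          √((2 * Real.pi) ^ Fintype.card κ * (B * Bᵀ).det)) := by
  have hBt : IsUnit Bᵀ.det := by rwa [det_transpose, isUnit_iff_ne_zero]
  have hquad : ∀ y, (B *ᵥ y + m - m) ⬝ᵥ (B * Bᵀ)⁻¹ *ᵥ (B *ᵥ y + m - m) = y ⬝ᵥ y := fun y => by
    rw [add_sub_cancel_right, mulVec_mulVec, ← vecMul_transpose, ← dotProduct_mulVec,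
      mulVec_mulVec, Matrix.mul_inv_rev, mul_assoc, nonsing_inv_mul _ (isUnit_iff_ne_zero.2 hB),
      mul_one, mul_nonsing_inv _ hBt, one_mulVec]
  set g : (κ → ℝ) → ℝ := fun x => Real.exp (-((x - m) ⬝ᵥ (B * Bᵀ)⁻¹ *ᵥ (x - m)) / 2) /
    √((2 * Real.pi) ^ Fintype.card κ * (B * Bᵀ).det) with hg
  have hdensity : ∀ y : κ → ℝ, Real.exp (-(y ⬝ᵥ y) / 2) / √((2 * Real.pi) ^ Fintype.card κ) =
      |B.det| * g (B *ᵥ y + m) := fun y => by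
    have := abs_ne_zero.2 hB
    simp only [hg]
    rw [hquad, det_mul, det_transpose, Real.sqrt_mul (by positivity), Real.sqrt_mul_self_eq_abs]
    field_simp
  have hg_meas : Measurable g := by fun_prop
  calc (Measure.pi fun _ => gaussianReal 0 1).map (fun y => B *ᵥ y + m)
      = (ENNReal.ofReal |B.det| • volume.withDensity
          ((fun x => ENNReal.ofReal (g x)) ∘ fun y => B *ᵥ y + m)).map
            (fun y => B *ᵥ y + m) := by
        rw [pi_gaussianReal_eq_withDensity, ← withDensity_smul _ (by fun_prop)]
        simp only [hdensity, ENNReal.ofReal_mul (abs_nonneg B.det)]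
        rfl
    _ = (ENNReal.ofReal |B.det| * ENNReal.ofReal |B.det⁻¹|) •
          volume.withDensity fun x => ENNReal.ofReal (g x) := by
        rw [Measure.map_smul, map_withDensity_comp _ (by fun_prop) (by fun_prop),
          map_mulVec_add_volume hB, withDensity_smul_measure, smul_smul]
    _ = volume.withDensity fun x => ENNReal.ofReal (g x) := by
        rw [← ENNReal.ofReal_mul (abs_nonneg _), ← abs_mul, mul_inv_cancel₀ hB, abs_one,
          ENNReal.ofReal_one, one_smul]

open scoped ComplexOrder MatrixOrder in
theorem map_ofLp_multivariateGaussian (m : EuclideanSpace ℝ κ) {S : Matrix κ κ ℝ}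
    (hS : S.PosDef) :
    (multivariateGaussian m S).map WithLp.ofLp = volume.withDensity fun x => ENNReal.ofReal
      (Real.exp (-((x - m.ofLp) ⬝ᵥ S⁻¹ *ᵥ (x - m.ofLp)) / 2) /
        √((2 * Real.pi) ^ Fintype.card κ * S.det)) := by
  have hsymm : (CFC.sqrt S)ᵀ = CFC.sqrt S := (CFC.sqrt_nonneg S).posSemidef.isHermitian
  have hmul : CFC.sqrt S * (CFC.sqrt S)ᵀ = S := by
    rw [hsymm, CFC.sqrt_mul_sqrt_self S hS.posSemidef.nonneg]
  have hdet : (CFC.sqrt S).det ≠ 0 := fun h0 =>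
    hS.det_pos.ne' (by rw [← hmul, det_mul, h0, zero_mul])
  have hpi := map_mulVec_add_pi_gaussianReal hdet m.ofLp
  rw [hmul] at hpi
  rw [← hpi, multivariateGaussian, ← map_pi_eq_stdGaussian,
    Measure.map_map (by fun_prop) (by fun_prop), Measure.map_map (by fun_prop) (by fun_prop)]
  congr with y
  simp [add_comm]

end GaussianDensity

section GaussianIntegrals

open Matrix

theorem isOpen_setOf_posDef {κ Θ : Type*} [Finite κ] [TopologicalSpace Θ] {A : Θ → Matrix κ κ ℝ}
    (hA : Continuous A) (hsymm : ∀ θ, (A θ).IsHermitian) : IsOpen {θ | (A θ).PosDef} := by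
  have := Fintype.ofFinite κ
  have hquad : Continuous fun p : Θ × (κ → ℝ) => p.2 ⬝ᵥ A p.1 *ᵥ p.2 := by fun_prop
  refine isOpen_iff_mem_nhds.2 fun θ₀ hθ₀ => ?_
  have hsphere : ∀ᶠ θ in 𝓝 θ₀, ∀ y ∈ Metric.sphere (0 : κ → ℝ) 1, 0 < y ⬝ᵥ A θ *ᵥ y := by
    refine (isCompact_sphere 0 1).eventually_forall_of_forall_eventually fun y hy => ?_
    refine hquad.continuousAt.eventually_const_lt ?_
    exact hθ₀.dotProduct_mulVec_pos (ne_zero_of_mem_unit_sphere ⟨y, hy⟩)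
  filter_upwards [hsphere] with θ hθ
  refine .of_dotProduct_mulVec_pos (hsymm θ) fun y hy => ?_
  have hscaled := hθ (‖y‖⁻¹ • y) (by simp [norm_smul, hy])
  rw [mulVec_smul, dotProduct_smul, smul_dotProduct, smul_smul, smul_eq_mul] at hscaled
  exact pos_of_mul_pos_right hscaled (by positivity)

variable {κ : Type*} [Fintype κ]

theorem integrable_exp_neg_quadratic [DecidableEq κ] {S : Matrix κ κ ℝ} (hS : S.PosDef)
    (m : κ → ℝ) :
    Integrable fun x : κ → ℝ => Real.exp (-((x - m) ⬝ᵥ S⁻¹ *ᵥ (x - m)) / 2) := by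
  have hZ : √((2 * Real.pi) ^ Fintype.card κ * S.det) ≠ 0 :=
    (Real.sqrt_pos.2 (mul_pos (by positivity) hS.det_pos)).ne'
  have hmass : (multivariateGaussian (WithLp.toLp 2 m) S).map WithLp.ofLp Set.univ < ⊤ := by
    rw [Measure.map_apply (by fun_prop) .univ]
    exact measure_lt_top _ _
  rw [map_ofLp_multivariateGaussian _ hS, withDensity_apply _ .univ, Measure.restrict_univ] at hmass
  refine (Integrable.mul_const (c := √((2 * Real.pi) ^ Fintype.card κ * S.det)) ⟨?_, ?_⟩).congr
    (.of_forall fun x => div_mul_cancel₀ _ hZ)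
  · fun_prop
  · rwa [hasFiniteIntegral_iff_ofReal (.of_forall fun x => by positivity)]

theorem integrable_exp_neg_quadratic_add_linear {A : Matrix κ κ ℝ} (hA : A.PosDef) (b : κ → ℝ) :
    Integrable fun x : κ → ℝ => Real.exp (-(x ⬝ᵥ A *ᵥ x) / 2 + b ⬝ᵥ x) := by
  classical
  have hAdet : IsUnit A.det := hA.det_pos.ne'.isUnit
  have hAinv : A *ᵥ A⁻¹ *ᵥ b = b := by rw [mulVec_mulVec, mul_nonsing_inv _ hAdet, one_mulVec]
  have hAt : Aᵀ = A := hA.isHermitian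
  have hsymm : ∀ x, (A⁻¹ *ᵥ b) ⬝ᵥ A *ᵥ x = b ⬝ᵥ x := fun x => by
    rw [dotProduct_mulVec, ← mulVec_transpose, hAt, hAinv]
  refine ((integrable_exp_neg_quadratic hA.inv (A⁻¹ *ᵥ b)).mul_const
    (Real.exp ((A⁻¹ *ᵥ b) ⬝ᵥ b / 2))).congr (.of_forall fun x => ?_)
  simp only [nonsing_inv_nonsing_inv _ hAdet, mulVec_sub, sub_dotProduct, dotProduct_sub, hsymm,
    hAinv, ← Real.exp_add]
  congr 1
  rw [dotProduct_comm x b]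
  ring

variable [DecidableEq κ]

theorem integral_exp_neg_quadratic {S : Matrix κ κ ℝ} (hS : S.PosDef) :
    ∫ x : κ → ℝ, Real.exp (-(x ⬝ᵥ S⁻¹ *ᵥ x) / 2) = √((2 * Real.pi) ^ Fintype.card κ * S.det) := by
  have hZ : √((2 * Real.pi) ^ Fintype.card κ * S.det) ≠ 0 :=
    (Real.sqrt_pos.2 (mul_pos (by positivity) hS.det_pos)).ne'
  have hmass : (multivariateGaussian 0 S).map WithLp.ofLp Set.univ = 1 := by
    rw [Measure.map_apply (by fun_prop) .univ]
    exact measure_univ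
  have hint := integrable_exp_neg_quadratic hS 0
  simp only [sub_zero] at hint
  rw [map_ofLp_multivariateGaussian _ hS, withDensity_apply _ .univ, Measure.restrict_univ] at hmass
  simp only [WithLp.ofLp_zero, sub_zero] at hmass
  rw [← ofReal_integral_eq_lintegral_ofReal (hint.div_const _)
    (.of_forall fun x => by positivity), integral_div, ENNReal.ofReal_eq_one] at hmass
  exact (div_eq_one_iff_eq hZ).1 hmass

theorem integrable_eval_mul_eval_multivariateGaussian (S : Matrix κ κ ℝ) (i j : κ) :
    Integrable (fun x => x i * x j) (multivariateGaussian 0 S) := by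
  have hL : ∀ i : κ, MemLp (fun x : EuclideanSpace ℝ κ => x i) 2 (multivariateGaussian 0 S) :=
    fun i => (EuclideanSpace.proj (𝕜 := ℝ) i).comp_memLp' IsGaussian.memLp_two_id
  exact (hL i).integrable_mul (hL j)

theorem integrable_eval_multivariateGaussian (S : Matrix κ κ ℝ) (i : κ) :
    Integrable (fun x => x i) (multivariateGaussian 0 S) :=
  (EuclideanSpace.proj (𝕜 := ℝ) i).integrable_comp IsGaussian.integrable_id

theorem integral_eval_multivariateGaussian (S : Matrix κ κ ℝ) (i : κ) :
    ∫ x, x i ∂multivariateGaussian 0 S = 0 := by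
  simpa using (EuclideanSpace.proj (𝕜 := ℝ) i).integral_comp_comm
    (IsGaussian.integrable_id (μ := multivariateGaussian 0 S))

theorem integral_eval_mul_eval_multivariateGaussian {S : Matrix κ κ ℝ} (hS : S.PosSemidef)
    (i j : κ) : ∫ x, x i * x j ∂multivariateGaussian 0 S = S i j := by
  rw [← covariance_eval_multivariateGaussian (μ := 0) hS, covariance,
    integral_eval_multivariateGaussian, integral_eval_multivariateGaussian]
  simp only [sub_zero]

theorem integral_linear_vecMulVec_add_multivariateGaussian {S : Matrix κ κ ℝ} (hS : S.PosSemidef)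
    (T : Matrix κ κ ℝ →ₗ[ℝ] ℝ) (ℓ : (κ → ℝ) →ₗ[ℝ] ℝ) :
    ∫ x : EuclideanSpace ℝ κ, T (vecMulVec x.ofLp x.ofLp) + ℓ x.ofLp ∂multivariateGaussian 0 S =
      T S := by
  obtain ⟨t, hT⟩ : ∃ t : κ → κ → ℝ, ∀ M, T M = ∑ i, ∑ j, M i j * t i j := by
    refine ⟨fun i j => T (single i j 1), fun M => ?_⟩
    conv_lhs => rw [matrix_eq_sum_single M]
    simp only [map_sum]
    refine Finset.sum_congr rfl fun i _ => Finset.sum_congr rfl fun j _ => ?_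
    rw [← smul_eq_mul, ← map_smul, smul_single, smul_eq_mul, mul_one]
  obtain ⟨s, hℓ⟩ : ∃ s : κ → ℝ, ∀ y, ℓ y = ∑ i, y i * s i :=
    ⟨fun i => ℓ (Pi.single i 1), fun y => by conv_lhs => rw [pi_eq_sum_univ' y]; simp⟩
  have hintT := fun i j =>
    (integrable_eval_mul_eval_multivariateGaussian S i j).mul_const (t i j)
  have hintℓ := fun i => (integrable_eval_multivariateGaussian S i).mul_const (s i)
  simp only [hT, hℓ, vecMulVec_apply]
  rw [integral_add (integrable_finsetSum _ fun i _ => integrable_finsetSum _ fun j _ => hintT i j)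
    (integrable_finsetSum _ fun i _ => hintℓ i), integral_finsetSum _ fun i _ => hintℓ i,
    integral_finsetSum _ fun i _ => integrable_finsetSum _ fun j _ => hintT i j]
  simp_rw [integral_finsetSum _ fun j _ => hintT _ j]
  simp only [integral_mul_const, integral_eval_mul_eval_multivariateGaussian hS,
    integral_eval_multivariateGaussian, zero_mul, Finset.sum_const_zero, add_zero]

end GaussianIntegrals

section GaussianStatistics

open Matrix

variable {κ ι : Type*} [DecidableEq κ] [Fintype ι]

/-- For a statistic whose quadratic part is `y ↦ T (y yᵀ)`, the symmetric matrix `P` for which the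
quadratic part of the exponent `⟨θ, φ⟩` is `-(yᵀ P y) / 2`. -/
def precision (T : Matrix κ κ ℝ →ₗ[ℝ] ι → ℝ) (θ : ι → ℝ) : Matrix κ κ ℝ :=
  of fun i j => -(θ ⬝ᵥ T (single i j 1 + single j i 1))

theorem isHermitian_precision (T : Matrix κ κ ℝ →ₗ[ℝ] ι → ℝ) (θ : ι → ℝ) :
    (precision T θ).IsHermitian := by
  ext i j
  simp [precision, add_comm]

theorem continuous_precision (T : Matrix κ κ ℝ →ₗ[ℝ] ι → ℝ) : Continuous (precision T) := by
  unfold precision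
  fun_prop

variable [Fintype κ]

theorem dotProduct_apply_of_isHermitian (T : Matrix κ κ ℝ →ₗ[ℝ] ι → ℝ) (θ : ι → ℝ)
    {M : Matrix κ κ ℝ} (hM : M.IsHermitian) :
    θ ⬝ᵥ T M = -trace (precision T θ * M) / 2 := by
  have hMt : ∀ i j, M j i = M i j := fun i j => hM.apply i j
  have hsplit : M + M = ∑ i, ∑ j, M j i • (single i j (1 : ℝ) + single j i 1) := by
    simp only [smul_add, Finset.sum_add_distrib, smul_single, smul_eq_mul, mul_one]
    rw [Finset.sum_comm (f := fun i j => single j i (M j i)), ← matrix_eq_sum_single]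
    simp only [hMt]
    rw [← matrix_eq_sum_single]
  have hdouble : θ ⬝ᵥ T (M + M) = -trace (precision T θ * M) := by
    rw [hsplit]
    simp only [map_sum, map_smul, dotProduct_sum, dotProduct_smul, trace, diag_apply, mul_apply,
      precision, of_apply, smul_eq_mul, neg_mul, Finset.sum_neg_distrib, neg_neg,
      mul_comm (M _ _)]
  rw [map_add, dotProduct_add] at hdouble
  linarith

theorem dotProduct_apply_vecMulVec (T : Matrix κ κ ℝ →ₗ[ℝ] ι → ℝ) (θ : ι → ℝ) (y : κ → ℝ) :
    θ ⬝ᵥ T (vecMulVec y y) = -(y ⬝ᵥ precision T θ *ᵥ y) / 2 := by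
  have hsymm : (vecMulVec y y).IsHermitian := transpose_vecMulVec y y
  rw [dotProduct_apply_of_isHermitian T θ hsymm, mul_vecMulVec, trace_vecMulVec, dotProduct_comm]

/-- Up to the measure-preserving change of variables `e`, the statistic `φ` consists of the
quadratic forms `T (y yᵀ)` plus the linear forms `ℓ y`, and the centred Gaussian densities with an
arbitrary precision matrix belong to its exponential family. -/
structure IsGaussianStatistic {Ω : Type*} [MeasurableSpace Ω] (ν : Measure Ω) (φ : Ω → ι → ℝ)
    (e : Ω ≃ᵐ (κ → ℝ)) (T : Matrix κ κ ℝ →ₗ[ℝ] ι → ℝ) (ℓ : (κ → ℝ) →ₗ[ℝ] ι → ℝ) : Prop where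
  measurePreserving : MeasurePreserving e ν volume
  statistic_eq : ∀ x, φ x = T (vecMulVec (e x) (e x)) + ℓ (e x)
  exists_precision_eq : ∀ A : Matrix κ κ ℝ, A.IsHermitian →
    ∃ θ, precision T θ = A ∧ ∀ y, θ ⬝ᵥ ℓ y = 0

namespace IsGaussianStatistic

open ExpFamily

variable {Ω : Type*} [MeasurableSpace Ω] {ν : Measure Ω} {φ : Ω → ι → ℝ} {e : Ω ≃ᵐ (κ → ℝ)}
  {T : Matrix κ κ ℝ →ₗ[ℝ] ι → ℝ} {ℓ : (κ → ℝ) →ₗ[ℝ] ι → ℝ} {θ : ι → ℝ} {S : Matrix κ κ ℝ}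

theorem neZero (h : IsGaussianStatistic ν φ e T ℓ) : NeZero ν := by
  refine ⟨fun hν => NeZero.ne (volume : Measure (κ → ℝ)) ?_⟩
  rw [← h.measurePreserving.map_eq, hν, Measure.map_zero]

theorem dotProduct_statistic (h : IsGaussianStatistic ν φ e T ℓ) (θ : ι → ℝ) (x : Ω) :
    θ ⬝ᵥ φ x = -(e x ⬝ᵥ precision T θ *ᵥ e x) / 2 + θ ⬝ᵥ ℓ (e x) := by
  rw [h.statistic_eq, dotProduct_add, dotProduct_apply_vecMulVec]

theorem mem_natDomain_of_posDef (h : IsGaussianStatistic ν φ e T ℓ)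
    (hθ : (precision T θ).PosDef) : θ ∈ natDomain ν φ := by
  refine mem_interior.2 ⟨_, fun θ hθ => ?_,
    isOpen_setOf_posDef (continuous_precision T) (isHermitian_precision T), hθ⟩
  have hlinear : ∀ y, θ ⬝ᵥ ℓ y = (fun i => θ ⬝ᵥ ℓ (Pi.single i 1)) ⬝ᵥ y := fun y => by
    conv_lhs => rw [pi_eq_sum_univ' y]
    simp only [map_sum, map_smul, dotProduct_sum, dotProduct_smul, smul_eq_mul]
    exact Finset.sum_congr rfl fun i _ => mul_comm _ _
  have hint := integrable_exp_neg_quadratic_add_linear hθ fun i => θ ⬝ᵥ ℓ (Pi.single i 1)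
  refine ((h.measurePreserving.integrable_comp_emb e.measurableEmbedding).2 hint).congr
    (.of_forall fun x => ?_)
  exact congrArg Real.exp ((h.dotProduct_statistic θ x).trans (by rw [hlinear])).symm

section Centred

variable (h : IsGaussianStatistic ν φ e T ℓ) (hS : S.PosDef) (hθ : precision T θ = S⁻¹)
  (hℓ : ∀ y, θ ⬝ᵥ ℓ y = 0)

include h hS hθ hℓ

theorem logPartition_eq_log_sqrt :
    logPartition ν φ θ = Real.log √((2 * Real.pi) ^ Fintype.card κ * S.det) := by
  rw [← integral_exp_neg_quadratic hS,
    ← h.measurePreserving.integral_comp e.measurableEmbedding, ← hθ]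
  refine congrArg Real.log (integral_congr_ae (.of_forall fun x => congrArg Real.exp ?_))
  exact (h.dotProduct_statistic θ x).trans (by rw [hℓ, add_zero])

theorem map_law_eq_map_multivariateGaussian :
    (law ν φ θ).map e = (multivariateGaussian 0 S).map WithLp.ofLp := by
  have hZ : 0 < √((2 * Real.pi) ^ Fintype.card κ * S.det) :=
    Real.sqrt_pos.2 (mul_pos (by positivity) hS.det_pos)
  have hdensity : (fun x => ENNReal.ofReal (density ν φ θ x)) =
      (fun y => ENNReal.ofReal (Real.exp (-(y ⬝ᵥ S⁻¹ *ᵥ y) / 2) /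
        √((2 * Real.pi) ^ Fintype.card κ * S.det))) ∘ e := by
    funext x
    refine congrArg ENNReal.ofReal ((Real.exp_sub _ _).trans ?_)
    rw [h.logPartition_eq_log_sqrt hS hθ hℓ, Real.exp_log hZ, ← hθ]
    refine congrArg (Real.exp · / _) ((h.dotProduct_statistic θ x).trans ?_)
    rw [hℓ, add_zero]
  rw [law, hdensity, map_withDensity_comp _ e.measurable (by fun_prop), h.measurePreserving.map_eq,
    map_ofLp_multivariateGaussian _ hS]
  simp only [WithLp.ofLp_zero, sub_zero]

theorem meanParam_eq_apply : meanParam ν φ θ = T S := by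
  funext j
  calc ∫ x, φ x j ∂law ν φ θ
    _ = ∫ y, T (vecMulVec y y) j + ℓ y j ∂(law ν φ θ).map e := by
      simp only [integral_map_equiv, h.statistic_eq, Pi.add_apply]
    _ = ∫ x : EuclideanSpace ℝ κ, T (vecMulVec x.ofLp x.ofLp) j + ℓ x.ofLp j
          ∂multivariateGaussian 0 S := by
      rw [h.map_law_eq_map_multivariateGaussian hS hθ hℓ]
      exact (MeasurableEquiv.toLp 2 (κ → ℝ)).symm.measurableEmbedding.integral_map _
    _ = T S j := integral_linear_vecMulVec_add_multivariateGaussian hS.posSemidef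
      (LinearMap.proj j ∘ₗ T) (LinearMap.proj j ∘ₗ ℓ)

end Centred

theorem apply_mem_meanDomain (h : IsGaussianStatistic ν φ e T ℓ) (hS : S.PosDef) :
    T S ∈ meanDomain ν φ := by
  obtain ⟨θ, hθ, hℓ⟩ := h.exists_precision_eq S⁻¹ hS.inv.isHermitian
  exact ⟨θ, h.mem_natDomain_of_posDef (hθ ▸ hS.inv), h.meanParam_eq_apply hS hθ hℓ⟩

theorem legendre_apply (h : IsGaussianStatistic ν φ e T ℓ) (hS : S.PosDef) :
    legendre ν φ (T S) =
      -(Fintype.card κ * (1 + Real.log (2 * Real.pi)) + Real.log S.det) / 2 := by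
  obtain ⟨θ, hθ, hℓ⟩ := h.exists_precision_eq S⁻¹ hS.inv.isHermitian
  have := h.neZero
  have hlog : Real.log √((2 * Real.pi) ^ Fintype.card κ * S.det) =
      (Fintype.card κ * Real.log (2 * Real.pi) + Real.log S.det) / 2 := by
    have hdet := hS.det_pos
    rw [Real.log_sqrt (by positivity), Real.log_mul (by positivity) hdet.ne', Real.log_pow]
  have htrace : trace (S⁻¹ * S) = Fintype.card κ := by
    rw [nonsing_inv_mul _ hS.det_pos.ne'.isUnit, trace_one]
  rw [← h.meanParam_eq_apply hS hθ hℓ, legendre_meanParam (h.mem_natDomain_of_posDef (hθ ▸ hS.inv)),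
    h.meanParam_eq_apply hS hθ hℓ, h.logPartition_eq_log_sqrt hS hθ hℓ,
    dotProduct_apply_of_isHermitian T θ hS.isHermitian, hθ, htrace, hlog]
  ring

end IsGaussianStatistic

end GaussianStatistics

section Equicovariance

variable (κ : Type*) [DecidableEq κ]

/-- The covariance matrix of variables `√ε Z_i + √t Z` with independent standard Gaussian `Z_i` and
`Z`: as `ε → 0` the variables become equal. -/
def equicovariance (ε t : ℝ) : Matrix κ κ ℝ :=
  ε • 1 + t • .of fun _ _ => 1

theorem equicovariance_combo (ε s t : ℝ) {a b : ℝ} (hab : a + b = 1) :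
    a • equicovariance κ ε s + b • equicovariance κ ε t = equicovariance κ ε (a * s + b * t) := by
  have hε : ε = a * ε + b * ε := by rw [← add_mul, hab, one_mul]
  conv_rhs => rw [equicovariance, hε]
  simp only [equicovariance, smul_add, smul_smul, add_smul]
  abel

theorem midpoint_equicovariance (ε s t : ℝ) :
    midpoint ℝ (equicovariance κ ε s) (equicovariance κ ε t) =
      equicovariance κ ε ((s + t) / 2) := by
  rw [midpoint_eq_smul_add, smul_add, equicovariance_combo κ ε s t (by norm_num)]
  congr 1
  simp only [invOf_eq_inv]
  ring

theorem equicovariance_submatrix (ε t : ℝ) (i : κ) :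
    (equicovariance κ ε t).submatrix (fun _ : Unit => i) (fun _ => i) =
      equicovariance Unit ε t := by
  ext
  simp [equicovariance]

theorem posDef_equicovariance [Finite κ] {ε t : ℝ} (hε : 0 < ε) (ht : 0 ≤ t) :
    (equicovariance κ ε t).PosDef := by
  have := Fintype.ofFinite κ
  have hones : (.of fun _ _ => 1 : Matrix κ κ ℝ).PosSemidef := by
    convert Matrix.posSemidef_vecMulVec_self_star fun _ : κ => (1 : ℝ)
    ext
    simp [Matrix.vecMulVec_apply]
  exact (Matrix.PosDef.one.smul hε).add_posSemidef (hones.smul ht)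

variable [Fintype κ]

theorem log_det_equicovariance {ε t : ℝ} (hε : 0 < ε) (ht : 0 ≤ t) :
    Real.log (equicovariance κ ε t).det =
      (Fintype.card κ - 1) * Real.log ε + Real.log (ε + Fintype.card κ * t) := by
  have hrankOne : equicovariance κ ε t = ε • (1 + Matrix.replicateCol Unit (fun _ : κ => t / ε) *
      Matrix.replicateRow Unit fun _ : κ => (1 : ℝ)) := by
    ext i j
    simp only [equicovariance, Matrix.add_apply, Matrix.smul_apply, Matrix.mul_apply,
      Matrix.of_apply, Matrix.replicateCol_apply, Matrix.replicateRow_apply, Finset.univ_unique,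
      Finset.sum_singleton, smul_eq_mul, mul_one]
    field_simp
  have hpos : 0 < ε + Fintype.card κ * t := by positivity
  have hdet : (equicovariance κ ε t).det =
      ε ^ Fintype.card κ * ((ε + Fintype.card κ * t) / ε) := by
    rw [hrankOne, Matrix.det_smul, Matrix.det_one_add_replicateCol_mul_replicateRow]
    simp only [dotProduct, one_mul, Finset.sum_const, Finset.card_univ, nsmul_eq_mul]
    field_simp
  rw [hdet, Real.log_mul (by positivity) (by positivity), Real.log_div hpos.ne' hε.ne',
    Real.log_pow]
  ring

end Equicovariance

namespace IsGaussianStatistic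

open ExpFamily

variable {κ ι Ω : Type*} [DecidableEq κ] [Fintype κ] [Fintype ι] [MeasurableSpace Ω]
  {ν : Measure Ω} {φ : Ω → ι → ℝ} {e : Ω ≃ᵐ (κ → ℝ)}
  {T : Matrix κ κ ℝ →ₗ[ℝ] ι → ℝ} {ℓ : (κ → ℝ) →ₗ[ℝ] ι → ℝ}

theorem segment_subset_meanDomain (h : IsGaussianStatistic ν φ e T ℓ) {ε s t : ℝ} (hε : 0 < ε)
    (hs : 0 ≤ s) (ht : 0 ≤ t) :
    segment ℝ (T (equicovariance κ ε s)) (T (equicovariance κ ε t)) ⊆ meanDomain ν φ := by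
  rintro _ ⟨a, b, ha, hb, hab, rfl⟩
  rw [← map_smul, ← map_smul, ← map_add, equicovariance_combo κ ε s t hab]
  exact h.apply_mem_meanDomain (posDef_equicovariance κ hε (by positivity))

theorem midpointGap_legendre (h : IsGaussianStatistic ν φ e T ℓ) {ε s t : ℝ} (hε : 0 < ε)
    (hs : 0 ≤ s) (ht : 0 ≤ t) :
    midpointGap (legendre ν φ) (T (equicovariance κ ε s)) (T (equicovariance κ ε t)) =
      ((Real.log (ε + Fintype.card κ * s) + Real.log (ε + Fintype.card κ * t)) / 2 -
        Real.log (ε + Fintype.card κ * ((s + t) / 2))) / 2 := by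
  have hmid : 0 ≤ (s + t) / 2 := by positivity
  have hmap : midpoint ℝ (T (equicovariance κ ε s)) (T (equicovariance κ ε t)) =
      T (equicovariance κ ε ((s + t) / 2)) := by
    rw [← midpoint_equicovariance, midpoint_eq_smul_add, midpoint_eq_smul_add, map_smul, map_add]
  rw [midpointGap, hmap, h.legendre_apply (posDef_equicovariance κ hε hs),
    h.legendre_apply (posDef_equicovariance κ hε ht),
    h.legendre_apply (posDef_equicovariance κ hε hmid), log_det_equicovariance κ hε hs,
    log_det_equicovariance κ hε ht, log_det_equicovariance κ hε hmid]
  ring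

theorem tendsto_midpointGap_legendre [Nonempty κ] (h : IsGaussianStatistic ν φ e T ℓ) {s t : ℝ}
    (hs : 0 < s) (ht : 0 < t) :
    Tendsto (fun ε => midpointGap (legendre ν φ) (T (equicovariance κ ε s))
        (T (equicovariance κ ε t)))
      (𝓝[>] 0) (𝓝 (((Real.log s + Real.log t) / 2 - Real.log ((s + t) / 2)) / 2)) := by
  have hn : (0 : ℝ) < Fintype.card κ := by exact_mod_cast Fintype.card_pos
  have hlog : ∀ r : ℝ, 0 < r → Tendsto (fun ε : ℝ => Real.log (ε + Fintype.card κ * r)) (𝓝[>] 0)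
      (𝓝 (Real.log (Fintype.card κ) + Real.log r)) := fun r hr => by
    rw [← Real.log_mul hn.ne' hr.ne']
    have hcont : Tendsto (fun ε : ℝ => ε + Fintype.card κ * r) (𝓝 0) (𝓝 (Fintype.card κ * r)) :=
      Continuous.tendsto' (by fun_prop) _ _ (zero_add _)
    exact (hcont.log (mul_pos hn hr).ne').mono_left nhdsWithin_le_nhds
  have hlim := ((((hlog s hs).add (hlog t ht)).div_const 2).sub
    (hlog ((s + t) / 2) (by positivity))).div_const 2
  refine (hlim.congr' ?_).trans_eq (by ring_nf)
  filter_upwards [self_mem_nhdsWithin] with ε hε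
  exact (h.midpointGap_legendre hε hs.le ht.le).symm

end IsGaussianStatistic

theorem LocalFamily.nullity_le_one_of_isGaussianStatistic {V : Type u} [Fintype V] [DecidableEq V]
    {H : FinHypergraph V} {X : V → Type v} [∀ i, MeasurableSpace (X i)]
    {I : LocalFamily.{u, v, w₁, w₂} H X} (hH : H.Connected)
    {θbar : ∀ α : H.edges, I.Idx α → ℝ} (h : IsConvexFunOn I.L (I.bethe θbar))
    {eF : ∀ α : H.edges, (∀ i : α.1, X i) ≃ᵐ (α.1 → ℝ)}
    {TF : ∀ α : H.edges, Matrix α.1 α.1 ℝ →ₗ[ℝ] I.Idx α → ℝ}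
    {ℓF : ∀ α : H.edges, (α.1 → ℝ) →ₗ[ℝ] I.Idx α → ℝ}
    (hF : ∀ α, IsGaussianStatistic (I.baseF α) (I.stat α) (eF α) (TF α) (ℓF α))
    {eV : ∀ i, X i ≃ᵐ (Unit → ℝ)} {TV : ∀ i, Matrix Unit Unit ℝ →ₗ[ℝ] I.J i → ℝ}
    {ℓV : ∀ i, (Unit → ℝ) →ₗ[ℝ] I.J i → ℝ}
    (hV : ∀ i, IsGaussianStatistic (I.ν i) (I.φV i) (eV i) (TV i) (ℓV i))
    (hT : ∀ (α : H.edges) (i : α.1) (j : I.J i) (M : Matrix α.1 α.1 ℝ),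
      TF α M (Sum.inr ⟨i, j⟩) = TV i (M.submatrix (fun _ => i) (fun _ => i)) j) :
    H.nullity ≤ 1 := by
  have : ∀ α : H.edges, Nonempty α.1 := fun α => (H.nonempty_of_mem α.1 α.2).to_subtype
  let x (t ε : ℝ) : I.Params :=
    (fun α => TF α (equicovariance α.1 ε t), fun i => TV i (equicovariance Unit ε t))
  have hconsistent : ∀ t ε (α : H.edges) (i : α.1) (j : I.J i),
      (x t ε).1 α (Sum.inr ⟨i, j⟩) = (x t ε).2 i j := fun t ε α i j => by
    simp only [x, hT, equicovariance_submatrix]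
  have hneg : ((Real.log 1 + Real.log 3) / 2 - Real.log ((1 + 3) / 2)) / 2 < 0 := by
    have hlog : Real.log 3 < Real.log (2 ^ 2) := Real.log_lt_log (by norm_num) (by norm_num)
    rw [Real.log_pow] at hlog
    norm_num at hlog ⊢
    linarith
  refine nullity_le_one_of_tendsto_midpointGap hH h (l := 𝓝[>] 0) (x := x 1) (y := x 3) ?_ hneg
    (fun α => (hF α).tendsto_midpointGap_legendre one_pos three_pos)
    fun i => (hV i).tendsto_midpointGap_legendre one_pos three_pos
  filter_upwards [self_mem_nhdsWithin] with ε hε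
  exact segment_subset_L
    (fun α => (hF α).segment_subset_meanDomain hε zero_le_one zero_le_three)
    (fun i => (hV i).segment_subset_meanDomain hε zero_le_one zero_le_three)
    (hconsistent 1 ε) (hconsistent 3 ε)

section PairStatistic

open Matrix

variable {κ J Ω : Type*} [MeasurableSpace Ω] {ν : Measure Ω}

/-- The symmetrized entry of a matrix at an unordered pair of indices. -/
def symEntry (M : Matrix κ κ ℝ) : Sym2 κ → ℝ :=
  Sym2.lift ⟨fun i j => (M i j + M j i) / 2, fun i j => congrArg (· / 2) (add_comm (M i j) _)⟩

theorem symEntry_vecMulVec (y : κ → ℝ) : symEntry (vecMulVec y y) = pairProd y := by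
  ext ⟨i, j⟩
  simp [symEntry, pairProd, vecMulVec_apply, mul_comm (y j)]

theorem symEntry_single_add_single [DecidableEq κ] (i j : κ) {s : Sym2 κ} (hs : ¬ s.IsDiag) :
    symEntry (single i j (1 : ℝ) + single j i 1) s = if s = s(i, j) then 1 else 0 := by
  obtain ⟨a, b⟩ := s
  have hab : a ≠ b := hs
  simp only [symEntry, Sym2.lift_mk, Matrix.add_apply, single_apply, Sym2.eq_iff]
  grind

/-- The linear map sending `y yᵀ` to the products `y i * y j` over unordered pairs of distinct
indices together with the multiples `y i ^ 2 • q` of a vector `q`. -/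
def pairQuadratic (q : J → ℝ) :
    Matrix κ κ ℝ →ₗ[ℝ] ({s : Sym2 κ // ¬ s.IsDiag} ⊕ (Σ _ : κ, J)) → ℝ where
  toFun M := Sum.elim (fun s => symEntry M s) fun p => M p.1 p.1 * q p.2
  map_add' M N := by
    ext (⟨⟨i, j⟩, hs⟩ | p)
    · exact (congrArg (· / (2 : ℝ)) (add_add_add_comm ..)).trans (add_div ..)
    · exact add_mul ..
  map_smul' c M := by
    ext (⟨⟨i, j⟩, hs⟩ | p)
    · exact (congrArg (· / (2 : ℝ)) (mul_add ..).symm).trans (mul_div_assoc ..)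
    · exact mul_assoc ..

/-- The linear map sending `y` to the multiples `y i • l` of a vector `l`. -/
def pairLinear (l : J → ℝ) :
    (κ → ℝ) →ₗ[ℝ] ({s : Sym2 κ // ¬ s.IsDiag} ⊕ (Σ _ : κ, J)) → ℝ where
  toFun y := Sum.elim 0 fun p => y p.1 * l p.2
  map_add' y z := by ext (s | p) <;> simp [add_mul]
  map_smul' c y := by ext (s | p) <;> simp [mul_assoc]

variable [Fintype J] {q l c : J → ℝ}

/-- The parameter whose pairing with `pairQuadratic q M` is `-tr (A M) / 2`, for symmetric `A` and
`M` and `c ⬝ᵥ q = 1`. -/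
def pairParameter (c : J → ℝ) (A : Matrix κ κ ℝ) :
    ({s : Sym2 κ // ¬ s.IsDiag} ⊕ (Σ _ : κ, J)) → ℝ :=
  Sum.elim (fun s => -symEntry A s) fun p => -(A p.1 p.1 / 2) * c p.2

variable [DecidableEq κ] [Fintype κ]

theorem pairParameter_dotProduct_pairLinear (hl : c ⬝ᵥ l = 0) (A : Matrix κ κ ℝ) (y : κ → ℝ) :
    pairParameter c A ⬝ᵥ pairLinear l y = 0 := by
  have hvertex : ∀ a b : ℝ, ∑ j, a * c j * (b * l j) = 0 := fun a b => by
    simp only [mul_mul_mul_comm a, ← Finset.mul_sum]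
    exact mul_eq_zero_of_right _ hl
  simp [pairParameter, pairLinear, dotProduct, Fintype.sum_sum_type, Fintype.sum_sigma, hvertex]

theorem pairParameter_dotProduct_pairQuadratic (hq : c ⬝ᵥ q = 1) (A M : Matrix κ κ ℝ) :
    pairParameter c A ⬝ᵥ pairQuadratic q M =
      -∑ s : {s : Sym2 κ // ¬ s.IsDiag}, symEntry A s * symEntry M s -
        ∑ i, A i i * M i i / 2 := by
  have hvertex : ∀ a b : ℝ, ∑ j, a * c j * (b * q j) = a * b := fun a b => by
    simp only [mul_mul_mul_comm a, ← Finset.mul_sum]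
    exact (congrArg (a * b * ·) hq).trans (mul_one _)
  simp [pairParameter, pairQuadratic, dotProduct, Fintype.sum_sum_type, Fintype.sum_sigma, hvertex,
    sub_eq_add_neg, mul_div_right_comm]

theorem precision_pairParameter (hq : c ⬝ᵥ q = 1) {A : Matrix κ κ ℝ} (hA : A.IsHermitian) :
    precision (pairQuadratic q) (pairParameter c A) = A := by
  ext i j
  rw [precision, of_apply, pairParameter_dotProduct_pairQuadratic hq]
  rcases eq_or_ne i j with rfl | hij
  · have hoff : ∀ s : {s : Sym2 κ // ¬ s.IsDiag},
        symEntry (single i i (1 : ℝ) + single i i 1) s = 0 := fun s => by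
      rw [symEntry_single_add_single i i s.2, if_neg]
      exact fun h => s.2 (h ▸ Sym2.mk_isDiag_iff.2 rfl)
    have hdiag : ∀ a, A a a * (single i i 1 a a + single i i 1 a a) / 2 =
        if i = a then A a a else 0 := fun a => by
      simp only [single_apply, and_self]
      split_ifs <;> ring
    simp [hoff, hdiag]
  · have hdiag : ∀ a, single i j (1 : ℝ) a a + single j i (1 : ℝ) a a = 0 := fun a => by
      simp only [single_apply]
      grind
    rw [Fintype.sum_eq_single ⟨s(i, j), by simpa using hij⟩ fun s hs => ?_]
    · have hji : A j i = A i j := hA.apply i j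
      rw [symEntry_single_add_single i j (by simpa using hij), if_pos rfl]
      simp [hdiag, symEntry, hji]
    · rw [symEntry_single_add_single i j s.2, if_neg fun h => hs (Subtype.ext h), mul_zero]

theorem isGaussianStatistic_pair (hq : c ⬝ᵥ q = 1) (hl : c ⬝ᵥ l = 0)
    {φ : Ω → {s : Sym2 κ // ¬ s.IsDiag} ⊕ (Σ _ : κ, J) → ℝ}
    {e : Ω ≃ᵐ (κ → ℝ)} (he : MeasurePreserving e ν volume)
    (hφ : ∀ x, φ x = Sum.elim (fun s => pairProd (e x) s.1)
      fun p : Σ _ : κ, J => e x p.1 ^ 2 * q p.2 + e x p.1 * l p.2) :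
    IsGaussianStatistic ν φ e (pairQuadratic q) (pairLinear l) where
  measurePreserving := he
  statistic_eq x := by
    rw [hφ]
    ext (s | p) <;> simp [pairQuadratic, pairLinear, symEntry_vecMulVec, vecMulVec_apply, sq]
  exists_precision_eq A hA := ⟨pairParameter c A, precision_pairParameter hq hA,
    pairParameter_dotProduct_pairLinear hl A⟩

theorem isGaussianStatistic_unit (hq : c ⬝ᵥ q = 1) (hl : c ⬝ᵥ l = 0) {φ : Ω → J → ℝ}
    {e : Ω ≃ᵐ (Unit → ℝ)} (he : MeasurePreserving e ν volume)
    (hφ : ∀ x, φ x = e x () ^ 2 • q + e x () • l) :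
    IsGaussianStatistic ν φ e ((entryLinearMap ℝ ℝ () ()).smulRight q)
      ((LinearMap.proj ()).smulRight l) where
  measurePreserving := he
  statistic_eq x := by simp [hφ, vecMulVec_apply, sq]
  exists_precision_eq A _ := by
    refine ⟨-(A () () / 2) • c, ?_, fun y => by simp [hl]⟩
    ext
    simp only [precision, of_apply, LinearMap.smulRight_apply, entryLinearMap_apply,
      Matrix.add_apply, single_apply_same, dotProduct_smul, smul_dotProduct, hq, smul_eq_mul]
    ring

end PairStatistic

theorem gaussian_nullity_le_one {V : Type u} [Fintype V] [DecidableEq V] {H : FinHypergraph V}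
    (hH : H.Connected) {θbar : ∀ α : H.edges, (gaussian H).Idx α → ℝ}
    (h : IsConvexFunOn (gaussian H).L ((gaussian H).bethe θbar)) : H.nullity ≤ 1 := by
  have hq : ![0, 1] ⬝ᵥ ![(0 : ℝ), 1] = 1 := by simp
  have hl : ![0, 1] ⬝ᵥ ![(1 : ℝ), 0] = 0 := by simp
  refine LocalFamily.nullity_le_one_of_isGaussianStatistic hH h
    (fun α => isGaussianStatistic_pair (κ := α.1) hq hl (e := .refl _) (.id _) fun x => ?_)
    (fun i => isGaussianStatistic_unit hq hl (volume_preserving_funUnique Unit ℝ).symm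
      fun x => ?_) fun α i j M => rfl
  · ext (s | ⟨i, j⟩)
    · rfl
    · fin_cases j <;> simp [LocalFamily.stat, gaussian]
  · ext j
    fin_cases j <;> simp [gaussian]

theorem fixedMeanGaussian_nullity_le_one {V : Type u} [Fintype V] [DecidableEq V]
    {H : FinHypergraph V} (hH : H.Connected) {m : V → ℝ}
    {θbar : ∀ α : H.edges, (fixedMeanGaussian H m).Idx α → ℝ}
    (h : IsConvexFunOn (fixedMeanGaussian H m).L ((fixedMeanGaussian H m).bethe θbar)) :
    H.nullity ≤ 1 := by
  have hq : (1 : Unit → ℝ) ⬝ᵥ 1 = 1 := by simp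
  have hl : (1 : Unit → ℝ) ⬝ᵥ 0 = 0 := by simp
  refine LocalFamily.nullity_le_one_of_isGaussianStatistic hH h
    (fun α => isGaussianStatistic_pair (κ := α.1) hq hl (e := .subRight fun i : α.1 => m i)
      (measurePreserving_sub_right volume _) fun x => ?_)
    (fun i => isGaussianStatistic_unit hq hl
      (e := (MeasurableEquiv.subRight (m i)).trans (MeasurableEquiv.funUnique Unit ℝ).symm)
      ((measurePreserving_sub_right volume (m i)).trans
      (volume_preserving_funUnique Unit ℝ).symm)
      fun x => ?_) fun α i j M => rfl
  · ext (s | ⟨i, j⟩)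
    · rfl
    · exact (add_zero _).symm.trans (congrArg₂ (· + ·) (mul_one _).symm (mul_zero _).symm)
  · ext j
    exact (add_zero _).symm.trans (congrArg₂ (· + ·) (mul_one _).symm (mul_zero _).symm)

end

end BetheHyper

theorem theorem6_general {V : Type*} [Fintype V] [DecidableEq V] (H : BetheHyper.FinHypergraph V)
    (hH : H.Connected) :
    (∀ (X : V → Type*) [∀ i, MeasurableSpace (X i)] (I : BetheHyper.LocalFamily H X),
      I.IsMarginallyClosed → (H.nullity = 0 ∨ H.nullity = 1) →
        ∀ θbar, BetheHyper.IsConvexFunOn I.L (I.bethe θbar)) ∧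
    (∀ (X : V → Type*) [∀ i, MeasurableSpace (X i)] [∀ i, MeasurableSingletonClass (X i)]
      [∀ i, Finite (X i)] [∀ i, Nontrivial (X i)] (I : BetheHyper.LocalFamily H X),
      I.IsMultinomial → ∀ θbar, BetheHyper.IsConvexFunOn I.L (I.bethe θbar) →
        (H.nullity = 0 ∨ H.nullity = 1)) ∧
    (∀ θbar, BetheHyper.IsConvexFunOn (BetheHyper.gaussian H).L
        ((BetheHyper.gaussian H).bethe θbar) →
      (H.nullity = 0 ∨ H.nullity = 1)) ∧
    (∀ (m : V → ℝ) (θbar), BetheHyper.IsConvexFunOn (BetheHyper.fixedMeanGaussian H m).L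
        ((BetheHyper.fixedMeanGaussian H m).bethe θbar) →
      (H.nullity = 0 ∨ H.nullity = 1)) := by
  have h01 : H.nullity = 0 ∨ H.nullity = 1 ↔ H.nullity ≤ 1 := by
    have := BetheHyper.FinHypergraph.nullity_nonneg_of_connected hH
    omega
  simp only [h01]
  exact ⟨fun X _ I hI h => hI.isConvexFunOn_bethe hH h,
    fun X _ _ _ _ I hI θbar => hI.nullity_le_one hH,
    fun θbar => BetheHyper.gaussian_nullity_le_one hH,
    fun m θbar => BetheHyper.fixedMeanGaussian_nullity_le_one hH⟩

theorem theorem6 {V : Type*} [Fintype V] [DecidableEq V] (H : BetheHyper.FinHypergraph V)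
    (hH : H.Connected) :
    -- (i) every inference family, every choice of compatibility functions
    (∀ (X : V → Type*) [∀ i, MeasurableSpace (X i)] (I : BetheHyper.LocalFamily H X),
      I.IsInferenceFamily → (H.nullity = 0 ∨ H.nullity = 1) →
        ∀ θbar, BetheHyper.IsConvexFunOn I.L (I.bethe θbar)) ∧
    -- (ii) multinomial
    (∀ (X : V → Type*) [∀ i, MeasurableSpace (X i)] [∀ i, MeasurableSingletonClass (X i)]
      [∀ i, Finite (X i)] [∀ i, Nontrivial (X i)] (I : BetheHyper.LocalFamily H X),
      I.IsMultinomial → ∀ θbar, BetheHyper.IsConvexFunOn I.L (I.bethe θbar) →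
        (H.nullity = 0 ∨ H.nullity = 1)) ∧
    -- (ii) Gaussian
    (∀ θbar, BetheHyper.IsConvexFunOn (BetheHyper.gaussian H).L
        ((BetheHyper.gaussian H).bethe θbar) →
      (H.nullity = 0 ∨ H.nullity = 1)) ∧
    -- (ii) fixed-mean Gaussian
    (∀ (m : V → ℝ) (θbar), BetheHyper.IsConvexFunOn (BetheHyper.fixedMeanGaussian H m).L
        ((BetheHyper.fixedMeanGaussian H m).bethe θbar) →
      (H.nullity = 0 ∨ H.nullity = 1)) :=
  have ⟨hconvex, hconverse⟩ := theorem6_general H hH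
  ⟨fun X _ I hI => hconvex X I hI.isMarginallyClosed, hconverse⟩
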